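/- For $n\in\mathbb N$ and $p\in[0,1]$, let $G(n,p)$ be the distribution on graphs with vertex set $[n]$ in which each of the $\binom n2$ possible edges is included independently with probability $p$. A sequence of events $(A_n)$ holds with high probability (w.h.p.) if $\mathbb P(A_n)\to 1$ as $n\to\infty$. For a finite simple graph $G$ and $k\ge 1$, let $s_k(G)$ be the number of isomorphism classes of $k$-vertex (not necessarily induced) subgraphs of $G$. For a constant $c$, the graph $G$ is called monotone $c$-tiny if $s_k(G)\le c^k$ for every $k\ge 1$. Theorem. The following holds: (1) for every real $d_1\ge 0$ there exists a real $c>0$ such that w.h.p. $G_n\sim G(n,d_1/n)$ is monotone $c$-tiny; and (2) for every real $c>0$ there exists a real $d_2\ge 0$ such that w.h.p. $G_n\sim G(n,d_2/n)$ is not monotone $c$-tiny. (Here $G(n,d/n)$ is considered only for $n\ge d$, $n\ge 1$, which is all that matters for $n\to\infty$.) -/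

import Mathlib

open Filter Topology

/-- The subgraphs of `G` with exactly `k` vertices, up to isomorphism. -/
def subgraphIsoSetoid {V : Type*} (G : SimpleGraph V) (k : ℕ) :
    Setoid {H : G.Subgraph // H.verts.encard = k} where
  r H K := Nonempty (H.1.coe ≃g K.1.coe)
  iseqv :=
    { refl := fun _ => ⟨SimpleGraph.Iso.refl⟩
      symm := fun ⟨f⟩ => ⟨f.symm⟩
      trans := fun ⟨f⟩ ⟨g⟩ => ⟨g.comp f⟩ }

/-- `s_k(G)`: the number of unlabeled `k`-vertex (not necessarily induced) subgraphs of `G`. -/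
noncomputable def numUnlabeledSubgraphs {V : Type*} (G : SimpleGraph V) (k : ℕ) : ℕ :=
  Nat.card (Quotient (subgraphIsoSetoid G k))

/-- `G` is monotone `c`-tiny: `s_k(G) ≤ c ^ k` for every `k ≥ 1`. -/
def MonotoneTiny {V : Type*} (c : ℝ) (G : SimpleGraph V) : Prop :=
  ∀ k : ℕ, 1 ≤ k → (numUnlabeledSubgraphs G k : ℝ) ≤ c ^ k

/-- The edge probability `d / n`. It is a probability only if `n ≥ d`; for the finitely many
smaller `n`, which do not matter in a limit `n → ∞`, the value is cut off at `1`. -/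
noncomputable def edgeProb (d : ℝ) (n : ℕ) : unitInterval :=
  Set.projIcc (0 : ℝ) 1 zero_le_one (d / n)

/-- The random graph `G_n ∼ G(n, d / n)` has the property `P` with high probability, that is,
`ℙ (P G_n) → 1` as `n → ∞`. -/
def WhpGnd (d : ℝ) (P : ∀ n : ℕ, SimpleGraph (Fin n) → Prop) : Prop :=
  Tendsto (fun n : ℕ => SimpleGraph.binomialRandom (Fin n) (edgeProb d n) {G | P n G})
    atTop (𝓝 1)

/-! Sparse side. Splitting off one component at a time turns a bound `C ^ j` on connected types into
`(2 * C) ^ k` for all types (`IsoCodable.of_connected`). A connected graph on `m + 1` vertices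
consists of an enumeration of its vertices, a breadth-first tree with monotone parent function (at
most `4 ^ m` choices) and a set of extra edges. The expected number of such structures in `G(n,
d/n)` is at most `n * C ^ (m + 1)`. Once `m` is at least a small multiple of `log n`, the factor `n`
is absorbed into the exponential and Markov's inequality bounds the number of subgraphs themselves.
For smaller `m`, with high probability no connected piece has two edges beyond a spanning tree,
since the second extra edge leaves a factor `1 / n`; the types are then counted abstractly as trees
with at most one added edge.

Dense side. For large `d`, any two disjoint sets of slightly more than `n / q` vertices are joined
by an edge (`whp_mixing`). Depth-first search then gives a path on `r + 1` vertices, nearly all of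
them, and these vertices span at least `(e + 1) * (r + 1)` edges. Adding subsets of `e * (r + 1)`
non-path edges to the path gives `2 ^ (e * (r + 1))` graphs. An isomorphism between two of them
carries the path to a Hamiltonian path, so each type occurs at most as often as there are
Hamiltonian paths, which is about `(2 * e + 3) ^ (r + 1)` by AM–GM. As `2 ^ e` outgrows `2 * e + 3`,
the base of the exponential is as large as desired. -/

/-! ### Edge probabilities and the first moment method -/

open MeasureTheory ProbabilityTheory unitInterval in
-- Independence of distinct edges. The choices `t = {True}` and `t = {False}` give the probabilities
-- of containing and of avoiding `F`.
lemma binomialRandom_real_pi {V : Type*} [Countable V] (p : unitInterval) (F : Finset (Sym2 V))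
    (hF : ∀ e ∈ F, ¬ e.IsDiag) (t : Set Prop) :
    (SimpleGraph.binomialRandom V p).real {G | ∀ e ∈ F, (e ∈ G.edgeSet) ∈ t} =
      (Set.indicator t (fun _ => (p : ℝ)) True +
        Set.indicator t (fun _ => 1 - (p : ℝ)) False) ^ F.card := by
  have hm : MeasurableSet {G : SimpleGraph V | ∀ e ∈ F, (e ∈ G.edgeSet) ∈ t} := by
    have : {G : SimpleGraph V | ∀ e ∈ F, (e ∈ G.edgeSet) ∈ t} =
        SimpleGraph.edgeSet ⁻¹' ⋂ e ∈ F, {s : Set (Sym2 V) | (e ∈ s) ∈ t} := by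
      ext G; simp
    rw [this]
    refine SimpleGraph.measurable_edgeSet (Finset.measurableSet_biInter _ fun e _ => ?_)
    exact (measurable_set_mem e) (MeasurableSet.of_discrete (s := t))
  -- `fromEdgeSet` discards loops, so membership is preserved only off the diagonal.
  have h1 : SimpleGraph.fromEdgeSet ⁻¹' {G : SimpleGraph V | ∀ e ∈ F, (e ∈ G.edgeSet) ∈ t} =
      {s : Set (Sym2 V) | ∀ e ∈ F, (e ∈ s) ∈ t} := by
    ext s
    refine forall₂_congr fun e he => ?_
    have : e ∈ (SimpleGraph.fromEdgeSet s).edgeSet ↔ e ∈ s := by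
      simp [hF e he]
    rw [this]
  have h2 : (SimpleGraph.binomialRandom V p) {G | ∀ e ∈ F, (e ∈ G.edgeSet) ∈ t} =
      ∏ e ∈ F, ((toNNReal p • Measure.dirac (e ∈ (Sym2.diagSetᶜ : Set (Sym2 V))) +
        toNNReal (σ p) • Measure.dirac False : Measure Prop) t) := by
    rw [SimpleGraph.binomialRandom_eq_map,
      Measure.map_apply SimpleGraph.measurable_fromEdgeSet hm, h1, setBernoulli_apply']
    rw [← Measure.infinitePi_pi _ (fun i _ => MeasurableSet.of_discrete)]
    congr 1
  rw [Measure.real, h2, ENNReal.toReal_prod]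
  rw [Finset.prod_congr rfl (g := fun _ => (Set.indicator t (fun _ => (p : ℝ)) True +
        Set.indicator t (fun _ => 1 - (p : ℝ)) False)), Finset.prod_const]
  intro e he
  have : (e ∈ (Sym2.diagSetᶜ : Set (Sym2 V))) = True := by simpa using hF e he
  rw [this]
  by_cases hT : True ∈ t <;> by_cases hF' : False ∈ t <;>
    simp [Set.indicator, hT, hF', ENNReal.toReal_add]

lemma binomialRandom_real_subset {V : Type*} [Countable V] (p : unitInterval)
    (F : Finset (Sym2 V)) (hF : ∀ e ∈ F, ¬ e.IsDiag) :
    (SimpleGraph.binomialRandom V p).real {G | (F : Set (Sym2 V)) ⊆ G.edgeSet} =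
      (p : ℝ) ^ F.card := by
  have := binomialRandom_real_pi p F hF {True}
  simpa [Set.indicator, Set.subset_def] using this

lemma binomialRandom_real_disjoint {V : Type*} [Countable V] (p : unitInterval)
    (F : Finset (Sym2 V)) (hF : ∀ e ∈ F, ¬ e.IsDiag) :
    (SimpleGraph.binomialRandom V p).real {G | ∀ e ∈ F, e ∉ G.edgeSet} =
      (1 - (p : ℝ)) ^ F.card := by
  have := binomialRandom_real_pi p F hF {False}
  simpa [Set.indicator, Set.subset_def] using this

open MeasureTheory in
/-- Markov's inequality for the number of members of a finite family of edge sets that are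
contained in a binomial random graph. -/
lemma binomialRandom_real_card_ge {V ι : Type*} [Countable V] (p : unitInterval)
    (s : Finset ι) (F : ι → Finset (Sym2 V)) (hF : ∀ i ∈ s, ∀ e ∈ F i, ¬ e.IsDiag)
    {a : ℝ} (ha : 0 < a) :
    (SimpleGraph.binomialRandom V p).real
        {G | a ≤ ({i | i ∈ s ∧ (F i : Set (Sym2 V)) ⊆ G.edgeSet}.ncard : ℝ)} ≤
      (∑ i ∈ s, (p : ℝ) ^ (F i).card) / a := by
  classical
  set μ := SimpleGraph.binomialRandom V p
  have hm : ∀ i, MeasurableSet {G : SimpleGraph V | (F i : Set (Sym2 V)) ⊆ G.edgeSet} := by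
    intro i
    have : {G : SimpleGraph V | (F i : Set (Sym2 V)) ⊆ G.edgeSet} =
        SimpleGraph.edgeSet ⁻¹' ⋂ e ∈ F i, {s : Set (Sym2 V) | e ∈ s} := by
      ext G; simp [Set.subset_def]
    rw [this]
    refine SimpleGraph.measurable_edgeSet (Finset.measurableSet_biInter _ fun e _ => ?_)
    exact measurableSet_setOfPred.2 (measurable_set_mem e)
  have hX : ∀ G : SimpleGraph V, (({i | i ∈ s ∧ (F i : Set (Sym2 V)) ⊆ G.edgeSet}.ncard : ℕ) : ℝ) =
      ∑ i ∈ s, Set.indicator {G : SimpleGraph V | (F i : Set (Sym2 V)) ⊆ G.edgeSet}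
        (fun _ => (1 : ℝ)) G := by
    intro G
    have : {i | i ∈ s ∧ (F i : Set (Sym2 V)) ⊆ G.edgeSet} =
      ((s.filter fun i => (F i : Set (Sym2 V)) ⊆ G.edgeSet : Finset ι) : Set ι) := by
      ext; simp
    rw [this, Set.ncard_coe_finset]
    simp [Set.indicator]
  have hint : ∀ i ∈ s, Integrable (Set.indicator
      {G : SimpleGraph V | (F i : Set (Sym2 V)) ⊆ G.edgeSet} (fun _ => (1 : ℝ))) μ :=
    fun i _ => (integrable_const 1).indicator (hm i)
  have key := mul_meas_ge_le_integral_of_nonneg (μ := μ)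
    (f := fun G => ∑ i ∈ s, Set.indicator {G : SimpleGraph V | (F i : Set (Sym2 V)) ⊆ G.edgeSet}
        (fun _ => (1 : ℝ)) G)
    (Eventually.of_forall fun G => Finset.sum_nonneg fun i _ =>
      Set.indicator_nonneg (fun _ _ => zero_le_one) _) (integrable_finsetSum s hint) a
  rw [integral_finsetSum _ hint] at key
  simp only [hX]
  rw [le_div_iff₀ ha, mul_comm]
  refine key.trans (le_of_eq (Finset.sum_congr rfl fun i hi => ?_))
  rw [integral_indicator_const _ (hm i), ← binomialRandom_real_subset p (F i) (hF i hi)]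
  simp [μ]

open MeasureTheory in
-- Subadditivity of the outer measure already gives `1 ≤ μ P + μ Pᶜ`, so no measurability of `P` is
-- needed.
lemma whpGnd_of_compl_le {d : ℝ} {P : ∀ n : ℕ, SimpleGraph (Fin n) → Prop} {ε : ℕ → ℝ}
    (hε : Tendsto ε atTop (𝓝 0))
    (h : ∀ᶠ n in atTop,
      (SimpleGraph.binomialRandom (Fin n) (edgeProb d n)).real {G | ¬ P n G} ≤ ε n) :
    WhpGnd d P := by
  have h0 : Tendsto (fun n => 1 - ENNReal.ofReal (ε n)) atTop (𝓝 1) := by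
    have : Tendsto (fun n => ENNReal.ofReal (ε n)) atTop (𝓝 0) := by
      simpa using ENNReal.tendsto_ofReal hε
    simpa using ENNReal.Tendsto.sub tendsto_const_nhds this (Or.inl ENNReal.one_ne_top)
  refine tendsto_of_tendsto_of_tendsto_of_le_of_le' h0 tendsto_const_nhds ?_
    (Eventually.of_forall fun n => prob_le_one)
  filter_upwards [h] with n hn
  rw [tsub_le_iff_right]
  calc (1 : ENNReal) = (SimpleGraph.binomialRandom (Fin n) (edgeProb d n)) Set.univ := by simp
    _ ≤ (SimpleGraph.binomialRandom (Fin n) (edgeProb d n)) ({G | P n G} ∪ {G | ¬ P n G}) :=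
      measure_mono fun G _ => em (P n G)
    _ ≤ _ := (measure_union_le _ _).trans (by
      gcongr
      rw [← ofReal_measureReal]
      exact ENNReal.ofReal_le_ofReal hn)

/-! ### Breadth-first codes of connected graphs -/

/-- Breadth-first search: one can order the vertices of a connected graph so that each vertex but
the first has an earlier neighbour, whose position depends monotonically on the vertex. -/
lemma SimpleGraph.Connected.exists_bfs_order_nat {V : Type*} [Fintype V] {H : SimpleGraph V}
    (hH : H.Connected) {t : ℕ} (ht : t < Fintype.card V) :
    ∃ (v : ℕ → V) (π : ℕ → ℕ), (∀ i ≤ t, ∀ j ≤ t, v i = v j → i = j) ∧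
      (∀ i < t, π i ≤ i) ∧ (∀ i < t, H.Adj (v (i + 1)) (v (π i))) ∧
      (∀ i j, i ≤ j → j < t → π i ≤ π j) ∧
      ∀ i < t, ∀ a < π i, ∀ w, H.Adj (v a) w → ∃ b ≤ t, v b = w := by
  classical
  induction t with
  | zero =>
    obtain ⟨r⟩ := hH.nonempty
    exact ⟨fun _ => r, fun _ => 0, by omega, by omega, by omega, by omega, by omega⟩
  | succ t ih =>
    obtain ⟨v, π, hinj, hlt, hadj, hmono, hvis⟩ := ih (by omega)
    -- A walk from `v 0` to an unvisited vertex must leave the visited set along some edge. The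
    -- least position `q` with an unvisited neighbour becomes the next parent.
    have hex : ∃ a, a ≤ t ∧ ∃ w, H.Adj (v a) w ∧ ∀ b ≤ t, v b ≠ w := by
      let S : Finset V := (Finset.range (t + 1)).image v
      have hS : S.card < Fintype.card V :=
        (Finset.card_image_le.trans (Finset.card_range _).le).trans_lt ht
      obtain ⟨z, hz⟩ : ∃ z, z ∉ S := by
        by_contra! h
        exact hS.ne ((Finset.eq_univ_iff_forall.2 h) ▸ Finset.card_univ)
      obtain ⟨p⟩ := hH.preconnected (v 0) z
      obtain ⟨d, -, h1, h2⟩ := p.exists_boundary_dart (S : Set V) (by simp [S]; exact ⟨0, by simp⟩)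
        (by simpa using hz)
      simp only [S, Finset.coe_image, Set.mem_image, Finset.coe_range, Set.mem_Iio,
        not_exists, not_and] at h1 h2
      obtain ⟨a, ha, hav⟩ := h1
      exact ⟨a, by omega, d.snd, hav ▸ d.adj, fun b hb => h2 b (by omega)⟩
    obtain ⟨hq, w, hw, hnew⟩ := Nat.find_spec hex
    have hmin := fun a (h : a < Nat.find hex) => Nat.find_min hex h
    generalize Nat.find hex = q at hq hw hmin
    -- Positions before an earlier parent have no unvisited neighbour left; this invariant makes the
    -- parents monotone.
    have hπq : ∀ i < t, π i ≤ q := by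
      intro i hi
      by_contra! h
      obtain ⟨b, hb, hbw⟩ := hvis i hi q h w hw
      exact hnew b hb hbw
    have hv : ∀ i ≤ t, Function.update v (t + 1) w i = v i := fun i hi =>
      Function.update_of_ne (by omega) _ _
    have hp : ∀ i < t, Function.update π t q i = π i := fun i hi =>
      Function.update_of_ne (by omega) _ _
    refine ⟨Function.update v (t + 1) w, Function.update π t q, ?_, ?_, ?_, ?_, ?_⟩
    · intro i hi j hj hij
      rcases Nat.lt_or_ge t i with h | h <;> rcases Nat.lt_or_ge t j with h' | h'
      · omega
      · obtain rfl : i = t + 1 := by omega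
        rw [hv j h', Function.update_self] at hij
        exact (hnew j h' hij.symm).elim
      · obtain rfl : j = t + 1 := by omega
        rw [hv i h, Function.update_self] at hij
        exact (hnew i h hij).elim
      · rw [hv i h, hv j h'] at hij
        exact hinj i h j h' hij
    · intro i hi
      rcases Nat.lt_or_ge i t with h | h
      · rw [hp i h]; exact hlt i h
      · obtain rfl : i = t := by omega
        simpa using hq
    · intro i hi
      rcases Nat.lt_or_ge i t with h | h
      · rw [hp i h, hv _ (by omega), hv _ ((hlt i h).trans (by omega))]; exact hadj i h
      · obtain rfl : i = t := by omega
        rw [Function.update_self, Function.update_self, hv q hq]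
        exact hw.symm
    · intro i j hij hj
      rcases Nat.lt_or_ge j t with h | h
      · rw [hp i (by omega), hp j h]; exact hmono i j hij h
      · obtain rfl : j = t := by omega
        rw [Function.update_self]
        rcases Nat.lt_or_ge i j with h' | h'
        · rw [hp i h']; exact hπq i h'
        · obtain rfl : i = j := by omega
          simp
    · intro i hi a ha u hu
      rcases Nat.lt_or_ge i t with h | h
      · rw [hp i h] at ha
        have := hlt i h
        rw [hv a (by omega)] at hu
        obtain ⟨b, hb, hbu⟩ := hvis i h a ha u hu
        exact ⟨b, by omega, by rw [hv b hb, hbu]⟩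
      · obtain rfl : i = t := by omega
        rw [Function.update_self] at ha
        rw [hv a (by omega)] at hu
        have := hmin a ha
        push Not at this
        obtain ⟨b, hb, hbu⟩ := this (by omega) u hu
        exact ⟨b, by omega, by rw [hv b hb, hbu]⟩

/-- The monotone parent functions of breadth-first search trees with `m` edges: `π i` is the parent
of the vertex `i + 1`. -/
def parentMaps (m : ℕ) : Finset (Fin m → Fin (m + 1)) :=
  {π | Monotone π ∧ ∀ i, π i < i.succ}

/-- The edges of the tree with parent function `π`. -/
def treeEdges {m : ℕ} (π : Fin m → Fin (m + 1)) : Finset (Sym2 (Fin (m + 1))) :=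
  Finset.univ.image fun i => s(i.succ, π i)

/-- For monotone `π` the map `i ↦ i + π i` is strictly increasing with values below `2 * m`, hence
determined by its range, one of `2 ^ (2 * m)` sets. -/
lemma card_parentMaps_le (m : ℕ) : (parentMaps m).card ≤ 4 ^ m := by
  classical
  let f : (Fin m → Fin (m + 1)) → Finset ℕ := fun π =>
    Finset.univ.image fun i : Fin m => (i : ℕ) + π i
  have hstrict : ∀ π ∈ parentMaps m, StrictMono fun i : Fin m => (i : ℕ) + (π i : ℕ) := by
    intro π hπ i j hij
    simp only [parentMaps, Finset.mem_filter] at hπ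
    have := hπ.2.1 hij.le
    have h1 : (π i : ℕ) ≤ π j := this
    have h2 : (i : ℕ) < j := hij
    show (i : ℕ) + (π i : ℕ) < j + π j
    omega
  have hmaps : ∀ π ∈ parentMaps m, f π ∈ (Finset.range (2 * m)).powerset := by
    intro π hπ
    simp only [f, Finset.mem_powerset]
    intro x hx
    obtain ⟨i, -, rfl⟩ := Finset.mem_image.1 hx
    have := (π i).is_lt
    have := i.is_lt
    simp only [Finset.mem_range]
    omega
  have hinj : Set.InjOn f (parentMaps m : Set (Fin m → Fin (m + 1))) := by
    intro π hπ π' hπ' h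
    have h1 := hstrict π hπ
    have h2 := hstrict π' hπ'
    have := StrictMono.range_inj h1 h2
    have hr : (fun i : Fin m => (i : ℕ) + (π i : ℕ)) = fun i : Fin m => (i : ℕ) + (π' i : ℕ) := by
      rw [← this]
      have := congrArg (fun s : Finset ℕ => (s : Set ℕ)) h
      simpa [f] using this
    funext i
    have := congrFun hr i
    exact Fin.ext (by omega)
  calc (parentMaps m).card ≤ ((Finset.range (2 * m)).powerset).card :=
        Finset.card_le_card_of_injOn f hmaps hinj
    _ = 4 ^ m := by rw [Finset.card_powerset, Finset.card_range, pow_mul]; norm_num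

/-- The larger endpoint `i.succ` of an edge recovers `i`. -/
lemma card_treeEdges {m : ℕ} {π : Fin m → Fin (m + 1)} (hπ : π ∈ parentMaps m) :
    (treeEdges π).card = m := by
  rw [treeEdges, Finset.card_image_of_injective, Finset.card_univ, Fintype.card_fin]
  intro i j hij
  simp only [parentMaps, Finset.mem_filter] at hπ
  have hi := hπ.2.2 i
  have hj := hπ.2.2 j
  simp only [Sym2.eq_iff] at hij
  rcases hij with ⟨h, -⟩ | ⟨h1, h2⟩
  · exact Fin.succ_injective _ h
  · exact absurd (h1 ▸ hj) (by rw [← h2]; exact not_lt.2 hi.le)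

lemma not_isDiag_of_mem_treeEdges {m : ℕ} {π : Fin m → Fin (m + 1)} (hπ : π ∈ parentMaps m)
    {e : Sym2 (Fin (m + 1))} (he : e ∈ treeEdges π) : ¬ e.IsDiag := by
  simp only [parentMaps, Finset.mem_filter] at hπ
  obtain ⟨i, -, rfl⟩ := Finset.mem_image.1 he
  simpa using (hπ.2.2 i).ne'

lemma SimpleGraph.Connected.exists_bfs_order {V : Type*} [Fintype V] {H : SimpleGraph V}
    (hH : H.Connected) {m : ℕ} (hm : Fintype.card V = m + 1) :
    ∃ (v : Fin (m + 1) ≃ V) (π : Fin m → Fin (m + 1)), π ∈ parentMaps m ∧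
      ∀ i, H.Adj (v i.succ) (v (π i)) := by
  obtain ⟨v, π, hinj, hlt, hadj, hmono, -⟩ := hH.exists_bfs_order_nat (t := m) (by omega)
  have hb : Function.Bijective fun i : Fin (m + 1) => v i := by
    rw [Fintype.bijective_iff_injective_and_card]
    exact ⟨fun i j hij => Fin.ext (hinj i (by omega) j (by omega) hij), by simp [hm]⟩
  refine ⟨Equiv.ofBijective _ hb, fun i => ⟨π i, by have := hlt i i.2; omega⟩, ?_, fun i => ?_⟩
  · simp only [parentMaps, Finset.mem_filter, Finset.mem_univ, true_and]
    exact ⟨fun i j hij => hmono i j hij j.2, fun i => Nat.lt_succ_of_le (hlt i i.2)⟩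
  · exact hadj i i.2

/-- A connected subgraph with `m + 1` vertices is described by an enumeration `v` of its vertices,
a breadth-first search tree and the set `A` of the remaining edges. -/
lemma SimpleGraph.Subgraph.exists_bfs_code {V : Type*} [Finite V] {G : SimpleGraph V}
    (H : G.Subgraph) (hH : H.coe.Connected) {m : ℕ} (hm : H.verts.encard = (m + 1 : ℕ)) :
    ∃ (v : Fin (m + 1) ↪ V) (π : Fin m → Fin (m + 1)) (A : Finset (Sym2 (Fin (m + 1)))),
      π ∈ parentMaps m ∧ Disjoint (treeEdges π) A ∧ (∀ e ∈ A, ¬ e.IsDiag) ∧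
      Set.range v = H.verts ∧ ∀ a b, H.Adj (v a) (v b) ↔ s(a, b) ∈ treeEdges π ∪ A := by
  classical
  have := Fintype.ofFinite H.verts
  have hcard : Fintype.card H.verts = m + 1 := by
    rw [← Nat.card_eq_fintype_card, Nat.card_coe_set_eq, Set.ncard, hm]; rfl
  obtain ⟨v, π, hπ, hadj⟩ := hH.exists_bfs_order hcard
  let E : Finset (Sym2 (Fin (m + 1))) :=
    {e | e.map (fun i => (v i : V)) ∈ H.edgeSet}
  have hE : ∀ a b, H.Adj (v a) (v b) ↔ s(a, b) ∈ E := by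
    intro a b; simp [E]
  have hTE : treeEdges π ⊆ E := by
    intro e he
    obtain ⟨i, -, rfl⟩ := Finset.mem_image.1 he
    exact (hE _ _).1 (hadj i)
  refine ⟨⟨fun i => (v i : V), Subtype.val_injective.comp v.injective⟩, π, E \ treeEdges π, hπ,
    Finset.disjoint_sdiff, ?_, ?_, ?_⟩
  · intro e
    induction e with
    | _ a b =>
      intro he
      have := (hE a b).2 (Finset.mem_sdiff.1 he).1
      intro hd
      simp only [Sym2.mk_isDiag_iff] at hd
      subst hd
      exact this.ne rfl
  · ext x
    constructor
    · rintro ⟨i, rfl⟩; exact (v i).2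
    · intro hx; exact ⟨v.symm ⟨x, hx⟩, by simp⟩
  · intro a b
    rw [Finset.union_sdiff_of_subset hTE]
    exact hE a b

lemma SimpleGraph.Subgraph.eq_of_code {V W : Type*} {G : SimpleGraph V} {H K : G.Subgraph}
    {v : W → V} {E : Set (Sym2 W)} (hH : Set.range v = H.verts) (hK : Set.range v = K.verts)
    (hHE : ∀ a b, H.Adj (v a) (v b) ↔ s(a, b) ∈ E)
    (hKE : ∀ a b, K.Adj (v a) (v b) ↔ s(a, b) ∈ E) : H = K := by
  ext x y
  · rw [← hH, ← hK]
  · constructor <;> intro h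
    · obtain ⟨a, rfl⟩ : x ∈ Set.range v := hH ▸ H.edge_vert h
      obtain ⟨b, rfl⟩ : y ∈ Set.range v := hH ▸ H.edge_vert h.symm
      exact (hKE a b).2 ((hHE a b).1 h)
    · obtain ⟨a, rfl⟩ : x ∈ Set.range v := hK ▸ K.edge_vert h
      obtain ⟨b, rfl⟩ : y ∈ Set.range v := hK ▸ K.edge_vert h.symm
      exact (hHE a b).2 ((hKE a b).1 h)

lemma SimpleGraph.Subgraph.nonempty_iso_of_code {V W : Type*} {G : SimpleGraph V}
    {H K : G.Subgraph} {v w : W ↪ V} {E : Set (Sym2 W)}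
    (hH : Set.range v = H.verts) (hK : Set.range w = K.verts)
    (hHE : ∀ a b, H.Adj (v a) (v b) ↔ s(a, b) ∈ E)
    (hKE : ∀ a b, K.Adj (w a) (w b) ↔ s(a, b) ∈ E) : Nonempty (H.coe ≃g K.coe) := by
  let f : W ≃ H.verts := (Equiv.ofInjective v v.injective).trans (Equiv.setCongr hH)
  let g : W ≃ K.verts := (Equiv.ofInjective w w.injective).trans (Equiv.setCongr hK)
  refine ⟨⟨f.symm.trans g, ?_⟩⟩
  intro x y
  obtain ⟨a, rfl⟩ := f.surjective x
  obtain ⟨b, rfl⟩ := f.surjective y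
  simp only [Equiv.trans_apply, Equiv.symm_apply_apply, SimpleGraph.Subgraph.coe_adj]
  exact (hKE a b).trans (hHE a b).symm

/-! ### Isomorphism types: from connected to arbitrary subgraphs -/

/-- The subgraphs of `G` with the property `P` have at most `N` isomorphism types. -/
def IsoCodable {V : Type*} {G : SimpleGraph V} (P : G.Subgraph → Prop) (N : ℕ) : Prop :=
  ∃ f : G.Subgraph → ℕ, (∀ H, P H → f H < N) ∧
    ∀ H K, P H → P K → f H = f K → Nonempty (H.coe ≃g K.coe)

lemma IsoCodable.of_finset {V α : Type*} {G : SimpleGraph V} {P : G.Subgraph → Prop} {N : ℕ}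
    (s : Finset α) (hs : s.card ≤ N) (f : G.Subgraph → α) (hf : ∀ H, P H → f H ∈ s)
    (hiso : ∀ H K, P H → P K → f H = f K → Nonempty (H.coe ≃g K.coe)) : IsoCodable P N := by
  classical
  refine ⟨fun H => if h : f H ∈ s then s.equivFin ⟨f H, h⟩ else 0, fun H hH => ?_,
    fun H K hH hK h => hiso H K hH hK ?_⟩
  · simp only [hf H hH, dite_true]
    exact (Fin.is_lt _).trans_le hs
  · simpa [hf H hH, hf K hK, Fin.val_inj] using h

lemma IsoCodable.numUnlabeledSubgraphs_le {V : Type*} {G : SimpleGraph V} {k N : ℕ}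
    (h : IsoCodable (fun H : G.Subgraph => H.verts.encard = k) N) :
    numUnlabeledSubgraphs G k ≤ N := by
  obtain ⟨f, hf, hiso⟩ := h
  let g : Quotient (subgraphIsoSetoid G k) → Fin N := fun q => ⟨f q.out.1, hf _ q.out.2⟩
  have hg : Function.Injective g := by
    intro q r hqr
    rw [← Quotient.out_equiv_out]
    exact hiso _ _ q.out.2 r.out.2 (by simpa [g] using hqr)
  simpa [numUnlabeledSubgraphs] using Nat.card_le_card_of_injective g hg

namespace SimpleGraph.Subgraph

variable {V : Type*} {G : SimpleGraph V}

/-- No edge crosses between `S` and its complement, so isomorphisms of the two parts glue along a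
disjoint sum. -/
lemma nonempty_iso_of_induce {H H' : G.Subgraph} {S S' : Set V}
    (hS : ∀ a b, H.Adj a b → (a ∈ S ↔ b ∈ S)) (hS' : ∀ a b, H'.Adj a b → (a ∈ S' ↔ b ∈ S'))
    (hSH : S ⊆ H.verts) (hSH' : S' ⊆ H'.verts)
    (h₁ : Nonempty ((H.induce S).coe ≃g (H'.induce S').coe))
    (h₂ : Nonempty ((H.induce (H.verts \ S)).coe ≃g (H'.induce (H'.verts \ S')).coe)) :
    Nonempty (H.coe ≃g H'.coe) := by
  obtain ⟨φ⟩ := h₁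
  obtain ⟨ψ⟩ := h₂
  have hφ : ∀ a : (H.induce S).verts, (φ a : V) ∈ S' := fun a => (φ a).2
  have hψ : ∀ a : (H.induce (H.verts \ S)).verts, (ψ a : V) ∈ H'.verts \ S' := fun a => (ψ a).2
  let v : (H.induce S).verts ⊕ (H.induce (H.verts \ S)).verts ↪ V :=
    ⟨Sum.elim Subtype.val Subtype.val, Subtype.val_injective.sumElim Subtype.val_injective
      fun a b hab => b.2.2 (hab ▸ a.2)⟩
  let w : (H.induce S).verts ⊕ (H.induce (H.verts \ S)).verts ↪ V :=
    ⟨Sum.elim (fun a => (φ a : V)) (fun a => (ψ a : V)),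
      (Subtype.val_injective.comp φ.injective).sumElim (Subtype.val_injective.comp ψ.injective)
      fun a b hab => (hψ b).2 (by rw [← hab]; exact hφ a)⟩
  refine nonempty_iso_of_code (v := v) (w := w)
    (E := {e | e.map v ∈ H.edgeSet}) ?_ ?_ (fun a b => by simp) ?_
  · ext x
    constructor
    · rintro ⟨a | a, rfl⟩
      · exact hSH a.2
      · exact a.2.1
    · intro hx
      by_cases h : x ∈ S
      · exact ⟨Sum.inl ⟨x, h⟩, rfl⟩
      · exact ⟨Sum.inr ⟨x, hx, h⟩, rfl⟩
  · ext x
    constructor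
    · rintro ⟨a | a, rfl⟩
      · exact hSH' (hφ a)
      · exact (hψ a).1
    · intro hx
      by_cases h : x ∈ S'
      · exact ⟨Sum.inl (φ.symm ⟨x, h⟩), by simp [w]⟩
      · exact ⟨Sum.inr (ψ.symm ⟨x, hx, h⟩), by simp [w]⟩
  · rintro (a | a) (b | b)
    · have := φ.map_rel_iff (a := a) (b := b)
      have h1 := a.2
      have h2 := b.2
      simp only [induce_verts] at h1 h2
      simpa [v, w, hφ, h1, h2] using this
    · have h1 : ¬ H'.Adj (φ a) (ψ b) := fun h => (hψ b).2 ((hS' _ _ h).1 (hφ a))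
      have h2 : ¬ H.Adj a b := fun h => b.2.2 ((hS _ _ h).1 a.2)
      simp [v, w, h1, h2]
    · have h1 : ¬ H'.Adj (ψ a) (φ b) := fun h => (hψ a).2 ((hS' _ _ h).2 (hφ b))
      have h2 : ¬ H.Adj a b := fun h => a.2.2 ((hS _ _ h).2 b.2)
      simp [v, w, h1, h2]
    · have := ψ.map_rel_iff (a := a) (b := b)
      have h1 := a.2
      have h2 := b.2
      have h3 := hψ a
      have h4 := hψ b
      simp only [induce_verts, Set.mem_sdiff] at h1 h2 h3 h4
      simpa [v, w, h1, h2, h3, h4] using this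

lemma exists_component (H : G.Subgraph) (hH : H.verts.Nonempty) :
    ∃ S ⊆ H.verts, S.Nonempty ∧ (∀ a b, H.Adj a b → (a ∈ S ↔ b ∈ S)) ∧
      (H.induce S).coe.Connected := by
  obtain ⟨x, hx⟩ := hH
  let S : Set V := {y | Relation.ReflTransGen H.Adj x y}
  have hxS : x ∈ S := Relation.ReflTransGen.refl
  refine ⟨S, ?_, ⟨x, hxS⟩, ?_, ?_⟩
  · intro y hy
    rcases Relation.ReflTransGen.cases_tail hy with h | ⟨z, -, hz⟩
    · exact h ▸ hx
    · exact H.edge_vert hz.symm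
  · exact fun a b hab => ⟨fun h => h.tail hab, fun h => h.tail hab.symm⟩
  · rw [SimpleGraph.connected_iff_exists_forall_reachable]
    refine ⟨⟨x, hxS⟩, ?_⟩
    have key : ∀ y (hy : Relation.ReflTransGen H.Adj x y),
        (H.induce S).coe.Reachable ⟨x, hxS⟩ ⟨y, hy⟩ := by
      intro y hy
      induction hy with
      | refl => exact Reachable.refl _
      | @tail b c hb hbc ih =>
        refine ih.trans (SimpleGraph.Adj.reachable ?_)
        simp only [coe_adj, induce_adj]
        exact ⟨hb, hb.tail hbc, hbc⟩
    rintro ⟨y, hy⟩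
    exact key y hy

end SimpleGraph.Subgraph

/-- If there are at most `C ^ j` connected subgraphs with `j` vertices up to isomorphism, for each
`j`, then there are at most `(2 * C) ^ k` subgraphs with `k` vertices up to isomorphism. -/
lemma IsoCodable.of_connected {V : Type*} [Finite V] {G : SimpleGraph V} {C : ℕ}
    (h : ∀ j : ℕ, 1 ≤ j → IsoCodable
      (fun H : G.Subgraph => H.verts.encard = j ∧ H.coe.Connected) (C ^ j)) (k : ℕ) :
    IsoCodable (fun H : G.Subgraph => H.verts.encard = k) ((2 * C) ^ k) := by
  classical
  induction k using Nat.strong_induction_on with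
  | _ k ih =>
  rcases Nat.eq_zero_or_pos k with rfl | hk
  · refine ⟨fun _ => 0, by simp, fun H K hH hK _ => ?_⟩
    simp only [Nat.cast_zero, Set.encard_eq_zero] at hH hK
    have : IsEmpty H.verts := Set.isEmpty_coe_sort.2 hH
    have : IsEmpty K.verts := Set.isEmpty_coe_sort.2 hK
    exact ⟨⟨Equiv.equivOfIsEmpty _ _, fun {a} => isEmptyElim a⟩⟩
  choose! f hf hfiso using h
  choose! g hg hgiso using ih
  have hcomp : ∀ H : G.Subgraph, ∃ S : Set V, H.verts.encard = k → S ⊆ H.verts ∧ S.Nonempty ∧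
      (∀ a b, H.Adj a b → (a ∈ S ↔ b ∈ S)) ∧ (H.induce S).coe.Connected := by
    intro H
    by_cases hH : H.verts.encard = k
    · obtain ⟨S, hS⟩ := H.exists_component (by
        rw [← Set.encard_pos, hH]; exact_mod_cast hk)
      exact ⟨S, fun _ => hS⟩
    · exact ⟨∅, fun h => (hH h).elim⟩
  choose S hS using hcomp
  have hcard : ∀ H : G.Subgraph, H.verts.encard = k → 1 ≤ (S H).ncard ∧ (S H).ncard ≤ k ∧
      (H.induce (S H)).verts.encard = (S H).ncard ∧
      (H.induce (H.verts \ S H)).verts.encard = (k - (S H).ncard : ℕ) := by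
    intro H hH
    obtain ⟨h1, h2, -, -⟩ := hS H hH
    have hHn : H.verts.ncard = k := by rw [Set.ncard, hH]; rfl
    refine ⟨(Set.ncard_pos (Set.toFinite _)).2 h2,
      hHn ▸ Set.ncard_le_ncard h1 (Set.toFinite _), ?_, ?_⟩
    · exact ((Set.toFinite (S H)).cast_ncard_eq).symm
    · rw [← hHn, ← Set.ncard_sdiff h1 (Set.toFinite _)]
      exact ((Set.toFinite (H.verts \ S H)).cast_ncard_eq).symm
  -- A code records the size `j` of one component, the code of that component and the code of the
  -- rest. The total is `C ^ k` times the sum of `2 ^ (k - j)` over `1 ≤ j ≤ k`, which is below `2 ^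
  -- k`.
  let s : Finset (Σ _ : ℕ, ℕ × ℕ) := (Finset.Icc 1 k).sigma fun j =>
    Finset.range (C ^ j) ×ˢ Finset.range ((2 * C) ^ (k - j))
  have hs : s.card ≤ (2 * C) ^ k := by
    rw [Finset.card_sigma]
    have h1 : ∀ j ∈ Finset.Icc 1 k, (Finset.range (C ^ j) ×ˢ
        Finset.range ((2 * C) ^ (k - j))).card = C ^ k * 2 ^ (k - j) := by
      intro j hj
      rw [Finset.card_product, Finset.card_range, Finset.card_range, mul_pow]
      rw [mul_comm (2 ^ _), ← mul_assoc, ← pow_add, Nat.add_sub_cancel' (Finset.mem_Icc.1 hj).2]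
    rw [Finset.sum_congr rfl h1, ← Finset.mul_sum, mul_pow, mul_comm (2 ^ k)]
    refine Nat.mul_le_mul_left _ ?_
    have h2 : ∑ j ∈ Finset.Icc 1 k, 2 ^ (k - j) = ∑ i ∈ Finset.range k, 2 ^ i := by
      refine Finset.sum_nbij' (fun j => k - j) (fun i => k - i) ?_ ?_ ?_ ?_ ?_ <;>
        simp only [Finset.mem_Icc, Finset.mem_range] <;> intros <;> first | omega | trivial
    rw [h2]
    exact (Nat.geomSum_lt (le_refl 2) (by simp)).le
  refine IsoCodable.of_finset s hs (fun H => ⟨(S H).ncard, f (S H).ncard (H.induce (S H)),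
    g (k - (S H).ncard) (H.induce (H.verts \ S H))⟩) ?_ ?_
  · intro H hH
    obtain ⟨h1, h2, h3, h4⟩ := hcard H hH
    simp only [s, Finset.mem_sigma, Finset.mem_Icc, Finset.mem_product, Finset.mem_range]
    exact ⟨⟨h1, h2⟩, hf _ h1 _ ⟨h3, (hS H hH).2.2.2⟩, hg _ (by omega) _ h4⟩
  · intro H K hH hK h
    obtain ⟨h1, h2, h3, h4⟩ := hcard H hH
    obtain ⟨-, -, k3, k4⟩ := hcard K hK
    simp only [Sigma.mk.injEq] at h
    obtain ⟨e1, e2⟩ := h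
    rw [← e1] at e2 k3 k4
    simp only [heq_eq_eq, Prod.mk.injEq] at e2
    obtain ⟨a1, a2, a3, a4⟩ := hS H hH
    obtain ⟨b1, b2, b3, b4⟩ := hS K hK
    exact SimpleGraph.Subgraph.nonempty_iso_of_induce a3 b3 a1 b1
      (hfiso _ h1 _ _ ⟨h3, a4⟩ ⟨k3, b4⟩ e2.1) (hgiso _ (by omega) _ _ h4 k4 e2.2)

/-! ### First moments of codes -/

/-- Codes of connected graphs with `m + 1` vertices in `V`: an enumeration of the vertices, the
parent function of a spanning tree, and a set of further edges. -/
abbrev BfsCode (V : Type*) (m : ℕ) : Type _ :=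
  (Fin (m + 1) ↪ V) × (Fin m → Fin (m + 1)) × Finset (Sym2 (Fin (m + 1)))

namespace BfsCode

open scoped Classical in
/-- The edge set described by a code. -/
noncomputable def edges {V : Type*} {m : ℕ} (c : BfsCode V m) : Finset (Sym2 V) :=
  (treeEdges c.2.1 ∪ c.2.2).image (Sym2.map c.1)

open scoped Classical in
/-- The codes whose set of further edges belongs to `𝒜`. -/
noncomputable def codes (V : Type*) [Fintype V] {m : ℕ}
    (𝒜 : Finset (Finset (Sym2 (Fin (m + 1))))) : Finset (BfsCode V m) :=
  (Finset.univ ×ˢ parentMaps m ×ˢ 𝒜).filter fun c =>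
    Disjoint (treeEdges c.2.1) c.2.2 ∧ ∀ e ∈ c.2.2, ¬ e.IsDiag

variable {V : Type*} [Fintype V] {m : ℕ} {𝒜 : Finset (Finset (Sym2 (Fin (m + 1))))}

lemma mem_codes {c : BfsCode V m} : c ∈ codes V 𝒜 ↔ c.2.1 ∈ parentMaps m ∧ c.2.2 ∈ 𝒜 ∧
    Disjoint (treeEdges c.2.1) c.2.2 ∧ ∀ e ∈ c.2.2, ¬ e.IsDiag := by
  simp [codes, and_assoc]

lemma card_edges {c : BfsCode V m} (hc : c ∈ codes V 𝒜) : c.edges.card = m + c.2.2.card := by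
  classical
  rw [mem_codes] at hc
  rw [edges, Finset.card_image_of_injective _ (Sym2.map.injective c.1.injective),
    Finset.card_union_of_disjoint hc.2.2.1, card_treeEdges hc.1]

lemma not_isDiag_of_mem_edges {c : BfsCode V m} (hc : c ∈ codes V 𝒜) {e : Sym2 V}
    (he : e ∈ c.edges) : ¬ e.IsDiag := by
  classical
  rw [mem_codes] at hc
  obtain ⟨e, he', rfl⟩ := Finset.mem_image.1 he
  rw [Sym2.isDiag_map c.1.injective]
  rcases Finset.mem_union.1 he' with h | h
  · exact not_isDiag_of_mem_treeEdges hc.1 h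
  · exact hc.2.2.2 e h

/-- The left side is the expected number of codes present. The factors bound the enumerations, the
parent functions and the weight `p ^ (m + A.card)`, once the side conditions on `A` are dropped. -/
lemma sum_pow_card_edges_le {p : ℝ} (hp : 0 ≤ p) :
    ∑ c ∈ codes V 𝒜, p ^ c.edges.card ≤
      (Fintype.card V : ℝ) ^ (m + 1) * (4 ^ m * p ^ m * ∑ A ∈ 𝒜, p ^ A.card) := by
  classical
  have hV : (Fintype.card (Fin (m + 1) ↪ V) : ℝ) ≤ (Fintype.card V : ℝ) ^ (m + 1) := by
    rw [Fintype.card_embedding_eq, Fintype.card_fin]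
    exact_mod_cast Nat.descFactorial_le_pow _ _
  have hπ : ((parentMaps m).card : ℝ) ≤ 4 ^ m := by exact_mod_cast card_parentMaps_le m
  have hA : 0 ≤ ∑ A ∈ 𝒜, p ^ A.card := Finset.sum_nonneg fun A _ => by positivity
  calc ∑ c ∈ codes V 𝒜, p ^ c.edges.card
      = ∑ c ∈ codes V 𝒜, p ^ (m + c.2.2.card) :=
        Finset.sum_congr rfl fun c hc => by rw [card_edges hc]
    _ ≤ ∑ c ∈ (Finset.univ : Finset (Fin (m + 1) ↪ V)) ×ˢ parentMaps m ×ˢ 𝒜,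
          p ^ (m + c.2.2.card) :=
        Finset.sum_le_sum_of_subset_of_nonneg (Finset.filter_subset _ _)
          fun c _ _ => by positivity
    _ = (Fintype.card (Fin (m + 1) ↪ V) : ℝ) *
          ((parentMaps m).card * p ^ m * ∑ A ∈ 𝒜, p ^ A.card) := by
        simp only [Finset.sum_product, Finset.sum_const, Finset.card_univ, nsmul_eq_mul, pow_add,
          ← Finset.mul_sum]
        ring
    _ ≤ _ := by gcongr

lemma exists_of_connected {G : SimpleGraph V} (H : G.Subgraph)
    (hH : H.verts.encard = (m + 1 : ℕ) ∧ H.coe.Connected) :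
    ∃ c : BfsCode V m, c ∈ codes V Finset.univ ∧ (c.edges : Set (Sym2 V)) ⊆ G.edgeSet ∧
      Set.range c.1 = H.verts ∧
      ∀ a b, H.Adj (c.1 a) (c.1 b) ↔ s(a, b) ∈ ((treeEdges c.2.1 ∪ c.2.2 : Finset _) : Set _) := by
  classical
  obtain ⟨v, π, A, hπ, hd, hA, hv, hadj⟩ := H.exists_bfs_code hH.2 hH.1
  refine ⟨(v, π, A), mem_codes.2 ⟨hπ, Finset.mem_univ _, hd, hA⟩, ?_, hv, hadj⟩
  intro e he
  obtain ⟨e, he', rfl⟩ := Finset.mem_image.1 (Finset.mem_coe.1 he)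
  induction e with
  | _ a b => exact ((hadj a b).2 he').adj_sub

/-- A code determines the subgraph itself, so even the labelled connected subgraphs number at most
`N`. -/
lemma isoCodable_of_ncard_le {G : SimpleGraph V} {N : ℕ}
    (h : {c : BfsCode V m | c ∈ codes V Finset.univ ∧
      (c.edges : Set (Sym2 V)) ⊆ G.edgeSet}.ncard ≤ N) :
    IsoCodable (fun H : G.Subgraph => H.verts.encard = (m + 1 : ℕ) ∧ H.coe.Connected) N := by
  classical
  choose f hf hfE hfv hfadj using exists_of_connected (m := m) (G := G)
  have hfin : {c : BfsCode V m | c ∈ codes V Finset.univ ∧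
      (c.edges : Set (Sym2 V)) ⊆ G.edgeSet}.Finite :=
    (codes V Finset.univ).finite_toSet.subset fun c hc => hc.1
  by_cases hex : ∃ H : G.Subgraph, H.verts.encard = (m + 1 : ℕ) ∧ H.coe.Connected
  · obtain ⟨H₀, hH₀⟩ := hex
    refine IsoCodable.of_finset hfin.toFinset ?_
      (fun H => if hH : H.verts.encard = (m + 1 : ℕ) ∧ H.coe.Connected then f H hH
        else f H₀ hH₀) ?_ ?_
    · rwa [← Set.ncard_eq_toFinset_card _ hfin]
    · intro H hH
      simp only [hH, and_self, dite_true, Set.Finite.mem_toFinset]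
      exact ⟨hf H hH, hfE H hH⟩
    · intro H K hH hK h
      simp only [hH, hK, and_self, dite_true] at h
      have hKv := hfv K hK
      have hKa := hfadj K hK
      rw [← h] at hKv hKa
      rw [SimpleGraph.Subgraph.eq_of_code (hfv H hH) hKv (hfadj H hH) hKa]
      exact ⟨SimpleGraph.Iso.refl⟩
  · push Not at hex
    exact ⟨fun _ => 0, fun H hH => (hex H hH.1 hH.2).elim, fun H _ hH => (hex H hH.1 hH.2).elim⟩

end BfsCode

namespace BfsCode

variable {V : Type*} [Fintype V] {m : ℕ}

/-- Two extra edges of a subgraph would already give a forbidden code, so at most one exists. The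
type depends only on the tree and this edge, not on the enumeration, which leaves a bound
independent of the number of vertices of `G`. -/
lemma isoCodable_of_forall_not_subset {G : SimpleGraph V}
    (h : ∀ c ∈ codes V (Finset.univ.filter fun A : Finset (Sym2 (Fin (m + 1))) => A.card = 2),
      ¬ (c.edges : Set (Sym2 V)) ⊆ G.edgeSet) :
    IsoCodable (fun H : G.Subgraph => H.verts.encard = (m + 1 : ℕ) ∧ H.coe.Connected)
      (16 ^ (m + 1)) := by
  classical
  have hcode : ∀ H : G.Subgraph, ∃ x : (Fin m → Fin (m + 1)) × Finset (Sym2 (Fin (m + 1))),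
      H.verts.encard = (m + 1 : ℕ) ∧ H.coe.Connected →
      x.1 ∈ parentMaps m ∧ x.2.card ≤ 1 ∧ ∃ v : Fin (m + 1) ↪ V, Set.range v = H.verts ∧
      ∀ a b, H.Adj (v a) (v b) ↔ s(a, b) ∈ ((treeEdges x.1 ∪ x.2 : Finset _) : Set _) := by
    intro H
    by_cases hH : H.verts.encard = (m + 1 : ℕ) ∧ H.coe.Connected
    · obtain ⟨⟨v, π, A⟩, hc, hE, hv, hadj⟩ := exists_of_connected H hH
      refine ⟨(π, A), fun _ => ⟨(mem_codes.1 hc).1, ?_, v, hv, hadj⟩⟩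
      by_contra! hA
      obtain ⟨B, hBA, hB⟩ := Finset.exists_subset_card_eq (show 2 ≤ A.card from hA)
      obtain ⟨h1, -, h3, h4⟩ := mem_codes.1 hc
      refine h (v, π, B) (mem_codes.2 ⟨h1, by simpa using hB, h3.mono_right hBA,
        fun e he => h4 e (hBA he)⟩) (subset_trans ?_ hE)
      exact_mod_cast Finset.image_subset_image (Finset.union_subset_union_right hBA)
    · exact ⟨(fun _ => 0, ∅), fun h => (hH h).elim⟩
  choose f hf using hcode
  refine IsoCodable.of_finset
    (parentMaps m ×ˢ insert ∅ (Finset.univ.image fun e : Sym2 (Fin (m + 1)) => {e})) ?_ f ?_ ?_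
  · have h1 : (insert ∅ (Finset.univ.image fun e : Sym2 (Fin (m + 1)) =>
        ({e} : Finset (Sym2 (Fin (m + 1)))))).card ≤ 4 ^ (m + 1) := by
      refine (Finset.card_insert_le _ _).trans ?_
      have h2 : (Finset.univ.image fun e : Sym2 (Fin (m + 1)) =>
          ({e} : Finset (Sym2 (Fin (m + 1))))).card ≤ (m + 2).choose 2 := by
        refine Finset.card_image_le.trans ?_
        rw [Finset.card_univ, Sym2.card, Fintype.card_fin]
      -- The inequality is strict to leave room for the empty set of extra edges.
      have h3 : (m + 2).choose 2 < 2 ^ (m + 2) := by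
        have := Nat.sum_range_choose (m + 2)
        rw [← this]
        have h0 : ∑ i ∈ ({0, 2} : Finset ℕ), (m + 2).choose i ≤
            ∑ i ∈ Finset.range (m + 2 + 1), (m + 2).choose i := by
          refine Finset.sum_le_sum_of_subset fun i hi => ?_
          simp only [Finset.mem_insert, Finset.mem_singleton] at hi
          simp only [Finset.mem_range]
          omega
        simp at h0
        omega
      have h4 : 2 ^ (m + 2) ≤ 4 ^ (m + 1) := by
        rw [show 4 = 2 ^ 2 by norm_num, ← pow_mul]
        exact Nat.pow_le_pow_right (by norm_num) (by omega)
      omega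
    rw [Finset.card_product]
    calc _ ≤ 4 ^ m * 4 ^ (m + 1) := Nat.mul_le_mul (card_parentMaps_le m) h1
      _ ≤ 4 ^ (m + 1) * 4 ^ (m + 1) :=
        Nat.mul_le_mul_right _ (Nat.pow_le_pow_right (by norm_num) (by omega))
      _ = 16 ^ (m + 1) := by rw [← mul_pow]; norm_num
  · intro H hH
    obtain ⟨h1, h2, -⟩ := hf H hH
    refine Finset.mem_product.2 ⟨h1, ?_⟩
    rcases Finset.card_le_one_iff_subset_singleton.1 h2 with ⟨e, he⟩
    rcases Finset.subset_singleton_iff.1 he with h | h <;> simp [h]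
  · intro H K hH hK h
    obtain ⟨-, -, v, hv, hva⟩ := hf H hH
    obtain ⟨-, -, w, hw, hwa⟩ := hf K hK
    rw [← h] at hwa
    exact SimpleGraph.Subgraph.nonempty_iso_of_code hv hw hva hwa

/-- The extra edges contribute `(1 + p) ^ (m + 2).choose 2`. Since `m + 1 ≤ n`, the exponent is at
most `(m + 1) * n`, so this is at most `exp (D * (m + 1))`. The tree contributes `n * (4 * n * p) ^
m`. -/
lemma sum_pow_card_edges_le_of_univ {n D : ℕ} {p : ℝ} (hn : 0 < n) (hp : 0 ≤ p)
    (hpn : p ≤ D / n) (hmn : m + 1 ≤ n) (hD : 1 ≤ D) :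
    ∑ c ∈ codes (Fin n) (Finset.univ : Finset (Finset (Sym2 (Fin (m + 1))))), p ^ c.edges.card ≤
      n * ((4 * D * 3 ^ D : ℕ) : ℝ) ^ (m + 1) := by
  have hn' : (0 : ℝ) < n := by exact_mod_cast hn
  have hD' : (1 : ℝ) ≤ D := by exact_mod_cast hD
  have h1 : ∑ A : Finset (Sym2 (Fin (m + 1))), p ^ A.card ≤ (3 ^ D) ^ (m + 1) := by
    have := Finset.sum_pow_mul_eq_add_pow p 1 (Finset.univ : Finset (Sym2 (Fin (m + 1))))
    simp only [one_pow, mul_one, Finset.powerset_univ] at this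
    rw [this, Finset.card_univ, Sym2.card, Fintype.card_fin]
    have hch : (m + 1 + 1).choose 2 ≤ (m + 1) * n := by
      rw [Nat.choose_two_right]
      refine Nat.div_le_of_le_mul ?_
      simp only [Nat.add_sub_cancel]
      nlinarith
    calc (p + 1) ^ (m + 1 + 1).choose 2 ≤ (Real.exp p) ^ ((m + 1) * n) :=
          (pow_le_pow_left₀ (by positivity) (Real.add_one_le_exp p) _).trans
            (pow_le_pow_right₀ (Real.one_le_exp hp) hch)
      _ = (Real.exp (n * p)) ^ (m + 1) := by
          rw [Real.exp_nat_mul, ← pow_mul, mul_comm n]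
      _ ≤ (Real.exp (D * 1)) ^ (m + 1) := by
          refine pow_le_pow_left₀ (Real.exp_pos _).le (Real.exp_le_exp.2 ?_) _
          rw [le_div_iff₀ hn'] at hpn
          linarith
      _ ≤ (3 ^ D) ^ (m + 1) := by
          rw [Real.exp_nat_mul]
          gcongr
          exact Real.exp_one_lt_three.le
  have h2 : (n : ℝ) * p ≤ D := by
    rw [le_div_iff₀ hn'] at hpn
    linarith
  refine (sum_pow_card_edges_le hp).trans ?_
  rw [Fintype.card_fin]
  calc (n : ℝ) ^ (m + 1) * (4 ^ m * p ^ m * ∑ A : Finset (Sym2 (Fin (m + 1))), p ^ A.card)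
      = n * ((4 * (n * p)) ^ m * ∑ A : Finset (Sym2 (Fin (m + 1))), p ^ A.card) := by
        rw [mul_pow, mul_pow]; ring
    _ ≤ n * ((4 * D) ^ m * (3 ^ D) ^ (m + 1)) := by gcongr
    _ ≤ n * ((4 * D) ^ (m + 1) * (3 ^ D) ^ (m + 1)) := by
        gcongr
        · linarith
        · omega
    _ = _ := by push_cast; rw [mul_pow _ (3 ^ D : ℝ)]

/-- There are `m + 2` edges on `m + 1` vertices, which leaves the factor `1 / n`. -/
lemma sum_pow_card_edges_le_of_card_two {n D : ℕ} {p : ℝ} (hn : 0 < n) (hp : 0 ≤ p)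
    (hpn : p ≤ D / n) (hD : 1 ≤ D) :
    ∑ c ∈ codes (Fin n) (Finset.univ.filter fun A : Finset (Sym2 (Fin (m + 1))) => A.card = 2),
      p ^ c.edges.card ≤ D * ((64 * D : ℕ) : ℝ) ^ (m + 1) / n := by
  have hn' : (0 : ℝ) < n := by exact_mod_cast hn
  have hD' : (1 : ℝ) ≤ D := by exact_mod_cast hD
  have h2 : (n : ℝ) * p ≤ D := by
    rw [le_div_iff₀ hn'] at hpn
    linarith
  have h1 : ∑ A ∈ Finset.univ.filter (fun A : Finset (Sym2 (Fin (m + 1))) => A.card = 2),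
      p ^ A.card ≤ 16 ^ (m + 1) * p ^ 2 := by
    rw [Finset.sum_congr rfl (g := fun _ => p ^ 2) (fun A hA => by
      rw [(Finset.mem_filter.1 hA).2]), Finset.sum_const, nsmul_eq_mul]
    gcongr
    rw [← Finset.powerset_univ, ← Finset.powersetCard_eq_filter, Finset.card_powersetCard, Finset.card_univ,
      Sym2.card, Fintype.card_fin]
    have h3 : (m + 1 + 1).choose 2 ≤ 4 ^ (m + 1) := by
      calc (m + 1 + 1).choose 2 ≤ 2 ^ (m + 1 + 1) := Nat.choose_le_two_pow _ _
        _ ≤ 4 ^ (m + 1) := by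
          rw [show 4 = 2 ^ 2 by norm_num, ← pow_mul]
          exact Nat.pow_le_pow_right (by norm_num) (by omega)
    have h4 : ((m + 1 + 1).choose 2).choose 2 ≤ 16 ^ (m + 1) := by
      calc ((m + 1 + 1).choose 2).choose 2 ≤ ((m + 1 + 1).choose 2) ^ 2 := Nat.choose_le_pow _ _
        _ ≤ (4 ^ (m + 1)) ^ 2 := Nat.pow_le_pow_left h3 _
        _ = 16 ^ (m + 1) := by rw [← pow_mul, mul_comm, pow_mul]; norm_num
    exact_mod_cast h4
  refine (sum_pow_card_edges_le hp).trans ?_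
  rw [Fintype.card_fin]
  calc (n : ℝ) ^ (m + 1) * (4 ^ m * p ^ m * _)
      ≤ (n : ℝ) ^ (m + 1) * (4 ^ m * p ^ m * (16 ^ (m + 1) * p ^ 2)) := by gcongr
    _ = 4 ^ m * 16 ^ (m + 1) * (n * p) ^ (m + 2) / n := by
        field_simp
        ring
    _ ≤ 4 ^ (m + 1) * 16 ^ (m + 1) * D ^ (m + 2) / n := by
        gcongr
        · norm_num
        · omega
    _ = _ := by
        push_cast
        rw [← mul_pow, mul_pow (64 : ℝ)]
        ring

end BfsCode

/-! ### Sparse random graphs are monotone tiny -/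

lemma edgeProb_le {d : ℝ} (hd : 0 ≤ d) (n : ℕ) : (edgeProb d n : ℝ) ≤ d / n := by
  rw [edgeProb, Set.coe_projIcc]
  exact max_le (by positivity) (min_le_right _ _)

/-- A graph in which each small connected subgraph has at most one edge more than a spanning tree,
and in which there are few larger connected subgraphs, is monotone tiny. -/
lemma monotoneTiny_of_codes {n L K : ℕ} {G : SimpleGraph (Fin n)} (hK : 16 ≤ K)
    (hsmall : ∀ m < L, ∀ c ∈ BfsCode.codes (Fin n)
      (Finset.univ.filter fun A : Finset (Sym2 (Fin (m + 1))) => A.card = 2),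
      ¬ (c.edges : Set (Sym2 (Fin n))) ⊆ G.edgeSet)
    (hlarge : ∀ m, L ≤ m → m < n → {c : BfsCode (Fin n) m | c ∈ BfsCode.codes (Fin n) Finset.univ ∧
      (c.edges : Set (Sym2 (Fin n))) ⊆ G.edgeSet}.ncard ≤ K ^ (m + 1)) :
    MonotoneTiny ((2 * K : ℕ) : ℝ) G := by
  intro k _
  have hconn : ∀ j : ℕ, 1 ≤ j → IsoCodable
      (fun H : G.Subgraph => H.verts.encard = j ∧ H.coe.Connected) (K ^ j) := by
    intro j hj
    obtain ⟨m, rfl⟩ : ∃ m, j = m + 1 := ⟨j - 1, by omega⟩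
    rcases Nat.lt_or_ge m L with hm | hm
    · obtain ⟨f, hf, hiso⟩ := BfsCode.isoCodable_of_forall_not_subset (hsmall m hm)
      exact ⟨f, fun H hH => (hf H hH).trans_le (Nat.pow_le_pow_left hK _), hiso⟩
    rcases Nat.lt_or_ge m n with hmn | hmn
    · exact BfsCode.isoCodable_of_ncard_le (hlarge m hm hmn)
    · have hno : ∀ H : G.Subgraph, ¬ H.verts.encard = (m + 1 : ℕ) := by
        intro H hH
        have h1 : H.verts.ncard = m + 1 := by rw [Set.ncard, hH]; rfl
        have h2 := Set.ncard_le_card H.verts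
        rw [Nat.card_fin] at h2
        omega
      exact ⟨fun _ => 0, fun H hH => (hno H hH.1).elim, fun H _ hH => (hno H hH.1).elim⟩
  exact_mod_cast (IsoCodable.of_connected hconn k).numUnlabeledSubgraphs_le

open MeasureTheory in
theorem exists_whp_monotoneTiny {d : ℝ} (hd : 0 ≤ d) :
    ∃ c : ℝ, 0 < c ∧ WhpGnd d (fun _ G => MonotoneTiny c G) := by
  obtain ⟨D, hD, hdD⟩ : ∃ D : ℕ, 1 ≤ D ∧ d ≤ D :=
    ⟨⌈d⌉₊ + 1, by omega, (Nat.le_ceil d).trans (by push_cast; linarith)⟩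
  -- With `L = Nat.log M n`, the square gives `(128 * D) ^ L ≤ √n`; the doubling of `64 * D` pays
  -- for the union bound over `m < L`. For `m ≥ L` one has `n ≤ M ^ (m + 1)`, so the factor `M ^ 3`
  -- in `K` turns the mean `n * C ^ (m + 1)` into a probability of at most `1 / n ^ 2`.
  set M : ℕ := (128 * D) ^ 2 with hM
  set C : ℕ := 4 * D * 3 ^ D with hC
  have hM1 : 1 < M := by nlinarith
  have hC1 : 1 ≤ C := Nat.one_le_iff_ne_zero.2 (by positivity)
  set K : ℕ := C * M ^ 3 with hKdef
  have hK : 16 ≤ K := by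
    have h1 : 16 ≤ M := by nlinarith
    calc 16 ≤ M := h1
      _ ≤ M ^ 3 := Nat.le_self_pow (by norm_num) _
      _ ≤ C * M ^ 3 := Nat.le_mul_of_pos_left _ hC1
  refine ⟨((2 * K : ℕ) : ℝ), by exact_mod_cast (by omega : 0 < 2 * K), ?_⟩
  refine whpGnd_of_compl_le (ε := fun n : ℕ => D / √(n : ℝ) + 1 / n) ?_ ?_
  · have h1 : Tendsto (fun n : ℕ => √(n : ℝ)) atTop atTop :=
      Real.tendsto_sqrt_atTop.comp tendsto_natCast_atTop_atTop
    simpa using (h1.const_div_atTop (D : ℝ)).add (tendsto_const_div_atTop_nhds_zero_nat (1 : ℝ))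
  filter_upwards [eventually_ge_atTop 1] with n hn
  set L := Nat.log M n with hL
  set p := edgeProb d n
  have hn' : (0 : ℝ) < n := by exact_mod_cast hn
  have hp0 : (0 : ℝ) ≤ p := p.2.1
  have hp : (p : ℝ) ≤ D / n := (edgeProb_le hd n).trans (by gcongr)
  let small : ∀ m : ℕ, Set (SimpleGraph (Fin n)) := fun m =>
    {G | (1 : ℝ) ≤ ({c : BfsCode (Fin n) m | c ∈ BfsCode.codes (Fin n)
      (Finset.univ.filter fun A : Finset (Sym2 (Fin (m + 1))) => A.card = 2) ∧
      (c.edges : Set (Sym2 (Fin n))) ⊆ G.edgeSet}.ncard : ℝ)}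
  let large : ∀ m : ℕ, Set (SimpleGraph (Fin n)) := fun m =>
    {G | (K : ℝ) ^ (m + 1) ≤ ({c : BfsCode (Fin n) m | c ∈ BfsCode.codes (Fin n) Finset.univ ∧
      (c.edges : Set (Sym2 (Fin n))) ⊆ G.edgeSet}.ncard : ℝ)}
  have hsub : {G : SimpleGraph (Fin n) | ¬ MonotoneTiny ((2 * K : ℕ) : ℝ) G} ⊆
      (⋃ m ∈ Finset.range L, small m) ∪ ⋃ m ∈ Finset.Ico L n, large m := by
    intro G hG
    by_contra hcon
    refine hG ?_
    simp only [Set.mem_union, Set.mem_iUnion, not_or, not_exists, Finset.mem_range,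
      Finset.mem_Ico] at hcon
    refine monotoneTiny_of_codes (L := L) hK (fun m hm c hc hcE => ?_) fun m hm hmn => ?_
    · refine hcon.1 m hm ?_
      simp only [small, Set.mem_ofPred_eq, Nat.one_le_cast]
      refine (Set.ncard_pos ?_).2 ⟨c, hc, hcE⟩
      exact (Finset.finite_toSet _).subset fun c hc => hc.1
    · have := hcon.2 m ⟨hm, hmn⟩
      simp only [large, Set.mem_ofPred_eq, not_le] at this
      exact_mod_cast this.le
  have hsmall : ∀ m ∈ Finset.range L,
      (SimpleGraph.binomialRandom (Fin n) p).real (small m) ≤ D * (64 * D : ℕ) ^ L / n := by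
    intro m hm
    rw [Finset.mem_range] at hm
    refine (binomialRandom_real_card_ge p _ _
      (fun c hc e he => BfsCode.not_isDiag_of_mem_edges hc he) one_pos).trans ?_
    rw [div_one]
    refine (BfsCode.sum_pow_card_edges_le_of_card_two hn hp0 hp hD).trans ?_
    gcongr
    · exact_mod_cast (by omega : 1 ≤ 64 * D)
    · omega
  have hlarge : ∀ m ∈ Finset.Ico L n,
      (SimpleGraph.binomialRandom (Fin n) p).real (large m) ≤ 1 / (n : ℝ) ^ 2 := by
    intro m hm
    rw [Finset.mem_Ico] at hm
    have hKpos : (0 : ℝ) < (K : ℝ) ^ (m + 1) := by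
      have : 0 < K := by omega
      positivity
    refine (binomialRandom_real_card_ge p _ _
      (fun c hc e he => BfsCode.not_isDiag_of_mem_edges hc he) hKpos).trans ?_
    have hnM : (n : ℝ) ≤ (M : ℝ) ^ (m + 1) := by
      have := Nat.lt_pow_succ_log_self hM1 n
      exact_mod_cast this.le.trans (Nat.pow_le_pow_right (by omega) (by omega))
    rw [div_le_div_iff₀ hKpos (by positivity), one_mul]
    calc _ ≤ (n * (C : ℝ) ^ (m + 1)) * (n : ℝ) ^ 2 := by
          gcongr
          exact BfsCode.sum_pow_card_edges_le_of_univ hn hp0 hp (by omega) hD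
      _ = (C : ℝ) ^ (m + 1) * (n : ℝ) ^ 3 := by ring
      _ ≤ (C : ℝ) ^ (m + 1) * ((M : ℝ) ^ (m + 1)) ^ 3 := by gcongr
      _ = (K : ℝ) ^ (m + 1) := by rw [hKdef]; push_cast; ring
  refine (measureReal_mono hsub).trans ((measureReal_union_le _ _).trans (add_le_add ?_ ?_))
  · refine (measureReal_biUnion_finset_le _ _).trans ((Finset.sum_le_sum hsmall).trans ?_)
    rw [Finset.sum_const, Finset.card_range, nsmul_eq_mul]
    have hsq : (((128 * D : ℕ) : ℝ) ^ L) ≤ √(n : ℝ) := by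
      refine Real.le_sqrt_of_sq_le ?_
      rw [← pow_mul, mul_comm L 2, pow_mul]
      exact_mod_cast Nat.pow_log_le_self M (by omega : n ≠ 0)
    have hLL : (L : ℝ) * ((64 * D : ℕ) : ℝ) ^ L ≤ ((128 * D : ℕ) : ℝ) ^ L := by
      have : ((128 * D : ℕ) : ℝ) = 2 * ((64 * D : ℕ) : ℝ) := by push_cast; ring
      rw [this, mul_pow]
      gcongr
      exact_mod_cast Nat.lt_two_pow_self.le
    calc (L : ℝ) * (D * ((64 * D : ℕ) : ℝ) ^ L / n)
        = D * (L * ((64 * D : ℕ) : ℝ) ^ L) / n := by ring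
      _ ≤ D * √(n : ℝ) / n := by gcongr; exact hLL.trans hsq
      _ = D / √(n : ℝ) := by
        rw [mul_div_assoc, Real.sqrt_div_self]
        ring
  · refine (measureReal_biUnion_finset_le _ _).trans ((Finset.sum_le_sum hlarge).trans ?_)
    rw [Finset.sum_const, Nat.card_Ico, nsmul_eq_mul]
    calc ((n - L : ℕ) : ℝ) * (1 / (n : ℝ) ^ 2) ≤ n * (1 / (n : ℝ) ^ 2) := by
          gcongr
          exact_mod_cast Nat.sub_le n L
      _ = 1 / (n : ℝ) := by field_simp

/-! ### Mixing graphs: long paths and many edges -/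

namespace SimpleGraph

/-- Any two disjoint sets of at least `m` vertices are joined by an edge. -/
def Mixing {V : Type*} (G : SimpleGraph V) (m : ℕ) : Prop :=
  ∀ A B : Finset V, Disjoint A B → m ≤ A.card → m ≤ B.card → ∃ a ∈ A, ∃ b ∈ B, G.Adj a b

lemma Mixing.comap {V W : Type*} {G : SimpleGraph V} {m : ℕ} (h : G.Mixing m) (f : W ↪ V) :
    (G.comap f).Mixing m := by
  intro A B hAB hA hB
  obtain ⟨a, ha, b, hb, hab⟩ := h (A.map f) (B.map f) ((Finset.disjoint_map f).2 hAB)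
    (by simpa using hA) (by simpa using hB)
  obtain ⟨a, ha', rfl⟩ := Finset.mem_map.1 ha
  obtain ⟨b, hb', rfl⟩ := Finset.mem_map.1 hb
  exact ⟨a, ha', b, hb', hab⟩

/-- Depth-first search, stopped after `t` steps: `S` is the set of explored vertices, `T` the set of
unvisited vertices, and the stack `U` is a path. -/
lemma exists_dfs_state {V : Type*} [Fintype V] [DecidableEq V] (G : SimpleGraph V) (t : ℕ)
    (ht : t ≤ Fintype.card V) :
    ∃ (S T : Finset V) (U : List V), U.Nodup ∧ U.IsChain G.Adj ∧ Disjoint S T ∧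
      (∀ x ∈ U, x ∉ S ∧ x ∉ T) ∧ (∀ x, x ∈ S ∨ x ∈ T ∨ x ∈ U) ∧
      (∀ a ∈ S, ∀ b ∈ T, ¬ G.Adj a b) ∧ T.card + t = Fintype.card V + S.card := by
  -- Each step either pushes a vertex of `T` onto the stack or pops the top of the stack into `S`;
  -- exactly one of `T.card` and `S.card` changes, by one.
  induction t with
  | zero => exact ⟨∅, Finset.univ, [], by simp⟩
  | succ t ih =>
    obtain ⟨S, T, U, hnd, hch, hST, hU, hall, hno, hcard⟩ := ih (by omega)
    have hpush : ∀ w ∈ T, (w :: U).IsChain G.Adj → ∃ (S T : Finset V) (U : List V),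
        U.Nodup ∧ U.IsChain G.Adj ∧ Disjoint S T ∧
        (∀ x ∈ U, x ∉ S ∧ x ∉ T) ∧ (∀ x, x ∈ S ∨ x ∈ T ∨ x ∈ U) ∧
        (∀ a ∈ S, ∀ b ∈ T, ¬ G.Adj a b) ∧ T.card + (t + 1) = Fintype.card V + S.card := by
      intro w hw hc
      refine ⟨S, T.erase w, w :: U, ?_, hc, hST.mono_right (Finset.erase_subset _ _), ?_, ?_, ?_, ?_⟩
      · exact List.nodup_cons.2 ⟨fun h => (hU w h).2 hw, hnd⟩
      · intro x hx
        rcases List.mem_cons.1 hx with rfl | hx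
        · exact ⟨fun h => Finset.disjoint_left.1 hST h hw, by simp⟩
        · exact ⟨(hU x hx).1, fun h => (hU x hx).2 (Finset.mem_of_mem_erase h)⟩
      · intro x
        by_cases hxw : x = w
        · simp [hxw]
        · simpa [hxw] using hall x
      · exact fun a ha b hb => hno a ha b (Finset.mem_of_mem_erase hb)
      · have := Finset.card_erase_add_one hw
        omega
    cases U with
    | nil =>
      obtain ⟨w, hw⟩ : T.Nonempty := Finset.card_pos.1 (by omega)
      exact hpush w hw (by simp)
    | cons u U =>
      by_cases hex : ∃ w ∈ T, G.Adj w u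
      · obtain ⟨w, hw, hwu⟩ := hex
        exact hpush w hw (List.isChain_cons_cons.2 ⟨hwu, hch⟩)
      · push Not at hex
        have huS := (hU u (by simp)).1
        have huT := (hU u (by simp)).2
        have hnd' := List.nodup_cons.1 hnd
        refine ⟨insert u S, T, U, hnd'.2, hch.tail, Finset.disjoint_insert_left.2 ⟨huT, hST⟩,
          ?_, ?_, ?_, ?_⟩
        · intro x hx
          have := hU x (List.mem_cons_of_mem _ hx)
          refine ⟨fun h => ?_, this.2⟩
          rcases Finset.mem_insert.1 h with rfl | h
          · exact hnd'.1 hx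
          · exact this.1 h
        · intro x
          have := hall x
          simp only [List.mem_cons, Finset.mem_insert] at this ⊢
          tauto
        · intro a ha b hb
          rcases Finset.mem_insert.1 ha with rfl | ha
          · exact fun h => hex b hb h.symm
          · exact hno a ha b hb
        · rw [Finset.card_insert_of_notMem huS]
          omega

/-- After `Fintype.card V` steps `S` and `T` have equal size and no edge between them. Mixing forces
that size to be at most `m`, and all other vertices lie on the stack. -/
lemma Mixing.exists_path {V : Type*} [Fintype V] {G : SimpleGraph V} {m : ℕ}
    (h : G.Mixing (m + 1)) (hm : 2 * m < Fintype.card V) :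
    ∃ (r : ℕ) (P : Fin (r + 1) ↪ V), Fintype.card V ≤ r + 1 + 2 * m ∧
      ∀ i : Fin r, G.Adj (P i.succ) (P i.castSucc) := by
  classical
  obtain ⟨S, T, U, hnd, hch, hST, hU, hall, hno, hcard⟩ := G.exists_dfs_state _ le_rfl
  have hS : S.card ≤ m := by
    by_contra! hS
    obtain ⟨a, ha, b, hb, hab⟩ := h S T hST hS (by omega)
    exact hno a ha b hb hab
  have hlen : Fintype.card V ≤ S.card + T.card + U.length := by
    have h1 : (Finset.univ : Finset V) ⊆ (S ∪ T) ∪ U.toFinset := by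
      intro x _
      have := hall x
      simp only [Finset.mem_union, List.mem_toFinset]
      tauto
    calc Fintype.card V ≤ ((S ∪ T) ∪ U.toFinset).card := Finset.card_le_card h1
      _ ≤ (S ∪ T).card + U.toFinset.card := Finset.card_union_le _ _
      _ ≤ S.card + T.card + U.length :=
        Nat.add_le_add (Finset.card_union_le _ _) (List.toFinset_card_le _)
  obtain ⟨r, hr⟩ : ∃ r, U.length = r + 1 := ⟨U.length - 1, by omega⟩
  refine ⟨r, ⟨fun i => U[(i : ℕ)]'(by omega), ?_⟩, by omega, fun i => ?_⟩
  · intro i j hij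
    exact Fin.ext ((List.Nodup.getElem_inj_iff hnd).1 hij)
  · exact (List.isChain_iff_getElem.1 hch i (by omega)).symm

/-- With fewer edges, at least half of the vertices would have degree at most `4 * e`. A maximal
independent set among them has at least `2 * m` vertices, and splitting it contradicts mixing. -/
lemma Mixing.le_ncard_edgeSet {W : Type*} [Fintype W] {G : SimpleGraph W} {m e : ℕ}
    (h : G.Mixing m)
    (hm : 4 * m * (4 * e + 1) ≤ Fintype.card W) : e * Fintype.card W ≤ G.edgeSet.ncard := by
  classical
  rw [← coe_edgeFinset, Set.ncard_coe_finset]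
  by_contra! hlt
  set low : Finset W := {x | G.degree x ≤ 4 * e} with hlow
  have hsum : ∑ x, G.degree x = 2 * G.edgeFinset.card :=
    G.sum_degrees_eq_twice_card_edges
  have hhigh : (Finset.univ.filter fun x => ¬ G.degree x ≤ 4 * e).card * (4 * e + 1) ≤
      2 * G.edgeFinset.card := by
    rw [← hsum, ← smul_eq_mul, ← Finset.sum_const]
    calc _ ≤ ∑ x ∈ Finset.univ.filter (fun x => ¬ G.degree x ≤ 4 * e), G.degree x :=
          Finset.sum_le_sum fun x hx => by
            have := (Finset.mem_filter.1 hx).2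
            omega
      _ ≤ _ := Finset.sum_le_sum_of_subset (Finset.filter_subset _ _)
  have hsplit : low.card + (Finset.univ.filter fun x => ¬ G.degree x ≤ 4 * e).card =
      Fintype.card W := by
    rw [hlow, Finset.card_filter_add_card_filter_not, Finset.card_univ]
  have hlowcard : Fintype.card W ≤ 2 * low.card := by
    by_contra! h1
    have h2 : Fintype.card W <
      2 * (Finset.univ.filter fun x => ¬ G.degree x ≤ 4 * e).card := by omega
    nlinarith
  obtain ⟨I, hI⟩ : ∃ I, Maximal (fun I : Finset W => I ⊆ low ∧
      ∀ a ∈ I, ∀ b ∈ I, ¬ G.Adj a b) I := by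
    refine (Set.toFinite {I : Finset W | I ⊆ low ∧
      ∀ a ∈ I, ∀ b ∈ I, ¬ G.Adj a b}).exists_maximal ⟨∅, by simp⟩
  have hcover : low ⊆ I.biUnion fun x => insert x (G.neighborFinset x) := by
    intro y hy
    rw [Finset.mem_biUnion]
    by_contra! hcon
    have hyI : ∀ x ∈ I, ¬ G.Adj x y := by
      intro x hx hxy
      exact hcon x hx (by simp [hxy])
    have hynot : y ∉ I := fun h => hcon y h (by simp)
    have hins : insert y I ⊆ low ∧ ∀ a ∈ insert y I, ∀ b ∈ insert y I, ¬ G.Adj a b := by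
      refine ⟨Finset.insert_subset hy hI.prop.1, ?_⟩
      intro a ha b hb
      rcases Finset.mem_insert.1 ha with rfl | ha' <;> rcases Finset.mem_insert.1 hb with rfl | hb'
      · exact G.loopless.irrefl _
      · exact fun h => hyI b hb' h.symm
      · exact hyI a ha'
      · exact hI.prop.2 a ha' b hb'
    exact hynot (hI.le_of_ge hins (Finset.subset_insert _ _) (Finset.mem_insert_self _ _))
  have hIcard : low.card ≤ I.card * (4 * e + 1) := by
    refine (Finset.card_le_card hcover).trans (Finset.card_biUnion_le_card_mul _ _ _ ?_)
    intro x hx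
    refine (Finset.card_insert_le _ _).trans ?_
    have := (Finset.mem_filter.1 (hI.prop.1 hx)).2
    rw [SimpleGraph.card_neighborFinset_eq_degree]
    omega
  have hI2 : 2 * m ≤ I.card := by
    by_contra! h1
    have h2 : I.card * (4 * e + 1) < 2 * m * (4 * e + 1) :=
      Nat.mul_lt_mul_of_pos_right h1 (by omega)
    nlinarith
  obtain ⟨A, hA, hAm⟩ := Finset.exists_subset_card_eq (show m ≤ I.card by omega)
  obtain ⟨a, ha, b, hb, hab⟩ := h A (I \ A) Finset.disjoint_sdiff hAm.ge
    (by rw [Finset.card_sdiff_of_subset hA]; omega)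
  exact hI.prop.2 a (hA ha) b (Finset.mem_sdiff.1 hb).1 hab

end SimpleGraph

/-! ### Counting subgraphs through Hamiltonian paths -/

/-- AM–GM, obtained by multiplying `a ≤ q * exp (a / q - 1)` over all factors. -/
lemma Finset.prod_le_pow_of_sum_le {ι : Type*} (s : Finset ι) (a : ι → ℕ) {q : ℕ} (hq : 0 < q)
    (h : ∑ i ∈ s, a i ≤ q * s.card) : ∏ i ∈ s, a i ≤ q ^ s.card := by
  have hq' : (0 : ℝ) < q := by exact_mod_cast hq
  have h1 : (∏ i ∈ s, (a i : ℝ)) ≤ (q : ℝ) ^ s.card := by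
    calc ∏ i ∈ s, (a i : ℝ) ≤ ∏ i ∈ s, (q * Real.exp (a i / q - 1)) := by
          refine Finset.prod_le_prod (fun i _ => Nat.cast_nonneg _) fun i _ => ?_
          have := Real.add_one_le_exp ((a i : ℝ) / q - 1)
          rw [sub_add_cancel, div_le_iff₀ hq'] at this
          linarith
      _ = (q : ℝ) ^ s.card * Real.exp (∑ i ∈ s, ((a i : ℝ) / q - 1)) := by
          rw [Finset.prod_mul_distrib, Finset.prod_const, Real.exp_sum]
      _ ≤ (q : ℝ) ^ s.card * 1 := by
          gcongr
          rw [Real.exp_le_one_iff, Finset.sum_sub_distrib, ← Finset.sum_div]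
          simp only [Finset.sum_const, nsmul_eq_mul, mul_one, sub_nonpos]
          rw [div_le_iff₀ hq', mul_comm]
          exact_mod_cast h
      _ = _ := mul_one _
  exact_mod_cast h1

namespace SimpleGraph

open scoped Classical in
/-- The Hamiltonian paths of a graph on `Fin (r + 1)`, as permutations of the vertices. -/
noncomputable def hamPaths {r : ℕ} (G : SimpleGraph (Fin (r + 1))) :
    Finset (Equiv.Perm (Fin (r + 1))) :=
  Finset.univ.filter fun σ => ∀ i : Fin r, G.Adj (σ i.succ) (σ i.castSucc)

lemma mem_hamPaths {r : ℕ} {G : SimpleGraph (Fin (r + 1))} {σ : Equiv.Perm (Fin (r + 1))} :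
    σ ∈ G.hamPaths ↔ ∀ i : Fin r, G.Adj (σ i.succ) (σ i.castSucc) := by
  simp [hamPaths]

/-- A path is determined by its start and its successor map. The last vertex is its own successor,
whence the `+ 1` at each degree. -/
lemma card_hamPaths_le {r : ℕ} (G : SimpleGraph (Fin (r + 1))) [DecidableRel G.Adj] :
    G.hamPaths.card ≤ (r + 1) * ∏ x, (G.degree x + 1) := by
  classical
  let next : Fin (r + 1) → Fin (r + 1) := fun i => if i = Fin.last r then i else i + 1
  let f : Equiv.Perm (Fin (r + 1)) → Fin (r + 1) × (Fin (r + 1) → Fin (r + 1)) := fun σ =>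
    (σ 0, fun x => σ (next (σ.symm x)))
  have hnext : ∀ i : Fin r, next i.castSucc = i.succ := by
    intro i
    simp [next, (Fin.castSucc_lt_last i).ne]
  let t : Finset (Fin (r + 1) × (Fin (r + 1) → Fin (r + 1))) :=
    Finset.univ ×ˢ Fintype.piFinset fun x => insert x (G.neighborFinset x)
  have ht : t.card = (r + 1) * ∏ x, (G.degree x + 1) := by
    rw [Finset.card_product, Finset.card_univ, Fintype.card_fin, Fintype.card_piFinset]
    congr 1
    refine Finset.prod_congr rfl fun x _ => ?_
    rw [Finset.card_insert_of_notMem (by simp), SimpleGraph.card_neighborFinset_eq_degree]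
  rw [← ht]
  refine Finset.card_le_card_of_injOn f ?_ ?_
  · intro σ hσ
    have hσ' := mem_hamPaths.1 (Finset.mem_coe.1 hσ)
    simp only [t, Finset.coe_product, Finset.coe_univ, Set.mem_prod, Set.mem_univ, true_and,
      Finset.mem_coe, Fintype.mem_piFinset, f]
    intro x
    obtain ⟨i, rfl⟩ := σ.surjective x
    rw [Equiv.symm_apply_apply]
    induction i using Fin.lastCases with
    | last => simp [next]
    | cast i =>
      rw [hnext]
      simpa using Or.inr (hσ' i).symm
  · intro σ _ τ _ h
    simp only [f, Prod.mk.injEq] at h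
    refine Equiv.ext fun i => ?_
    induction i using Fin.induction with
    | zero => exact h.1
    | succ i ih =>
      have := congrFun h.2 (σ i.castSucc)
      rw [Equiv.symm_apply_apply, hnext, ih, Equiv.symm_apply_apply, hnext] at this
      exact this

/-- A graph with a path through `r + 1` vertices that span many edges has many subgraphs with
`r + 1` vertices up to isomorphism. -/
lemma two_pow_le_numUnlabeledSubgraphs {V : Type*} [Finite V] {G : SimpleGraph V} {r e : ℕ}
    (P : Fin (r + 1) ↪ V) (hP : ∀ i : Fin r, G.Adj (P i.succ) (P i.castSucc))
    (he : (e + 1) * (r + 1) ≤ (G.comap P).edgeSet.ncard) :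
    2 ^ (e * (r + 1)) ≤
      (r + 1) * (2 * e + 3) ^ (r + 1) * numUnlabeledSubgraphs G (r + 1) := by
  classical
  obtain ⟨G', hG', he⟩ : ∃ G' : SimpleGraph (Fin (r + 1)),
      (∀ a b, G'.Adj a b ↔ G.Adj (P a) (P b)) ∧ (e + 1) * (r + 1) ≤ G'.edgeFinset.card :=
    ⟨G.comap P, fun _ _ => Iff.rfl, by rwa [← Set.ncard_coe_finset, coe_edgeFinset]⟩
  let T : Finset (Sym2 (Fin (r + 1))) := treeEdges Fin.castSucc
  have hTcard : T.card ≤ r := Finset.card_image_le.trans (by simp)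
  have hT : T ⊆ G'.edgeFinset := by
    intro x hx
    obtain ⟨i, -, rfl⟩ := Finset.mem_image.1 hx
    simpa [hG'] using hP i
  -- The path uses at most `r` of the `(e + 1) * (r + 1)` edges.
  obtain ⟨B, hB, hBcard⟩ : ∃ B ⊆ G'.edgeFinset \ T, B.card = e * (r + 1) := by
    refine Finset.exists_subset_card_eq ?_
    rw [Finset.card_sdiff_of_subset hT]
    have : (e + 1) * (r + 1) = e * (r + 1) + (r + 1) := by ring
    omega
  let F : Finset (Sym2 (Fin (r + 1))) → SimpleGraph (Fin (r + 1)) := fun A =>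
    fromEdgeSet ((T ∪ A : Finset _) : Set (Sym2 (Fin (r + 1))))
  have hTA : ∀ A ⊆ B, T ∪ A ⊆ G'.edgeFinset := fun A hA =>
    Finset.union_subset hT (hA.trans (hB.trans Finset.sdiff_subset))
  have hFedge : ∀ A ⊆ B, (F A).edgeSet = ((T ∪ A : Finset _) : Set (Sym2 (Fin (r + 1)))) := by
    intro A hA
    simp only [F, edgeSet_fromEdgeSet]
    refine sdiff_eq_left.2 (Set.disjoint_left.2 fun x hx hd => ?_)
    exact G'.not_isDiag_of_mem_edgeSet (mem_edgeFinset.1 (hTA A hA hx)) hd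
  have hFle : ∀ A ⊆ B, F A ≤ G' := by
    intro A hA
    rw [← edgeSet_subset_edgeSet, hFedge A hA]
    exact fun x hx => mem_edgeFinset.1 (hTA A hA hx)
  have hFmono : ∀ A ⊆ B, F A ≤ F B := by
    intro A hA
    rw [← edgeSet_subset_edgeSet, hFedge A hA, hFedge B subset_rfl]
    exact_mod_cast Finset.union_subset_union_right hA
  have hFinj : ∀ A ⊆ B, ∀ A' ⊆ B, F A = F A' → A = A' := by
    intro A hA A' hA' h
    have h1 : T ∪ A = T ∪ A' := by
      have := hFedge A hA
      rw [h, hFedge A' hA'] at this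
      exact_mod_cast this.symm
    have hd : ∀ A ⊆ B, (T ∪ A) \ T = A := fun A hA =>
      Finset.union_sdiff_cancel_left
        (Finset.disjoint_left.2 fun x hx hxA => (Finset.mem_sdiff.1 (hB (hA hxA))).2 hx)
    rw [← hd A hA, h1, hd A' hA']
  have hFpath : ∀ A ⊆ B, ∀ i : Fin r, (F A).Adj i.succ i.castSucc := by
    intro A hA i
    rw [← mem_edgeSet, hFedge A hA]
    exact_mod_cast Finset.mem_union_left _ (Finset.mem_image_of_mem _ (Finset.mem_univ i))
  have hsub : ∀ A, ∃ H : {H : G.Subgraph // H.verts.encard = (r + 1 : ℕ)},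
      A ⊆ B → Nonempty (F A ≃g H.1.coe) := by
    have hcopy : ∀ A ⊆ B, ∃ H : {H : G.Subgraph // H.verts.encard = (r + 1 : ℕ)},
        Nonempty (F A ≃g H.1.coe) := by
      intro A hA
      let c : Copy (F A) G := ⟨⟨P, fun {a b} hab => (hG' a b).1 (hFle A hA hab)⟩, P.injective⟩
      refine ⟨⟨c.toSubgraph, ?_⟩, ⟨c.isoToSubgraph⟩⟩
      have : c.toSubgraph.verts = Set.range P := by
        simp only [Copy.toSubgraph, Subgraph.map_verts, Subgraph.verts_top, Set.image_univ]
        rfl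
      rw [this, ← Set.image_univ, P.injective.encard_image, Set.encard_univ]
      simp
    intro A
    by_cases hA : A ⊆ B
    · exact (hcopy A hA).imp fun _ h _ => h
    · exact (hcopy ∅ (Finset.empty_subset _)).imp fun _ _ h => (hA h).elim
  choose S hS using hsub
  let cls : Finset (Sym2 (Fin (r + 1))) → Quotient (subgraphIsoSetoid G (r + 1)) := fun A =>
    Quotient.mk _ (S A)
  have hfin : Finite (Quotient (subgraphIsoSetoid G (r + 1))) := inferInstance
  have := Fintype.ofFinite (Quotient (subgraphIsoSetoid G (r + 1)))
  have hham : (F B).hamPaths.card ≤ (r + 1) * (2 * e + 3) ^ (r + 1) := by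
    refine (F B).card_hamPaths_le.trans (Nat.mul_le_mul_left _ ?_)
    have hsum : ∑ x, ((F B).degree x + 1) ≤
        (2 * e + 3) * (Finset.univ : Finset (Fin (r + 1))).card := by
      rw [Finset.sum_add_distrib, sum_degrees_eq_twice_card_edges,
        ← Set.ncard_coe_finset, coe_edgeFinset, hFedge B subset_rfl, Set.ncard_coe_finset]
      have := Finset.card_union_le T B
      simp only [Finset.sum_const, Finset.card_univ, Fintype.card_fin, smul_eq_mul]
      nlinarith
    simpa using Finset.prod_le_pow_of_sum_le Finset.univ (fun x => (F B).degree x + 1)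
      (by omega : 0 < 2 * e + 3) hsum
  -- Within a class, an isomorphism `F A ≃g F A₀` carries the path to a Hamiltonian path of `F A₀ ≤
  -- F B`. As a permutation it determines `F A`, hence `A`.
  have hfib : ∀ q ∈ B.powerset.image cls, (B.powerset.filter fun A => cls A = q).card ≤
      (F B).hamPaths.card := by
    intro q hq
    obtain ⟨A₀, hA₀, rfl⟩ := Finset.mem_image.1 hq
    rw [Finset.mem_powerset] at hA₀
    have hiso : ∀ A, ∃ σ : Equiv.Perm (Fin (r + 1)), A ⊆ B → cls A = cls A₀ →
        ∀ x y, (F A₀).Adj (σ x) (σ y) ↔ (F A).Adj x y := by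
      intro A
      by_cases h : A ⊆ B ∧ cls A = cls A₀
      · obtain ⟨φ⟩ := hS A h.1
        obtain ⟨φ₀⟩ := hS A₀ hA₀
        obtain ⟨ψ⟩ : Nonempty ((S A).1.coe ≃g (S A₀).1.coe) := Quotient.exact h.2
        let θ : F A ≃g F A₀ := (φ.trans ψ).trans φ₀.symm
        exact ⟨θ.toEquiv, fun _ _ x y => θ.map_rel_iff⟩
      · exact ⟨1, fun h1 h2 => (h ⟨h1, h2⟩).elim⟩
    choose σ hσ using hiso
    refine Finset.card_le_card_of_injOn σ ?_ ?_
    · intro A hA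
      obtain ⟨hA, hcls⟩ := Finset.mem_filter.1 (Finset.mem_coe.1 hA)
      rw [Finset.mem_powerset] at hA
      refine mem_hamPaths.2 fun i => hFmono A₀ hA₀ ((hσ A hA hcls _ _).2 (hFpath A hA i))
    · intro A hA A' hA' h
      obtain ⟨hA, hcls⟩ := Finset.mem_filter.1 (Finset.mem_coe.1 hA)
      obtain ⟨hA', hcls'⟩ := Finset.mem_filter.1 (Finset.mem_coe.1 hA')
      rw [Finset.mem_powerset] at hA hA'
      refine hFinj A hA A' hA' ?_
      ext x y
      rw [← hσ A hA hcls, ← hσ A' hA' hcls', h]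
  calc 2 ^ (e * (r + 1)) = B.powerset.card := by rw [Finset.card_powerset, hBcard]
    _ ≤ (F B).hamPaths.card * (B.powerset.image cls).card :=
      Finset.card_le_mul_card_image _ _ hfib
    _ ≤ (r + 1) * (2 * e + 3) ^ (r + 1) * numUnlabeledSubgraphs G (r + 1) := by
      refine Nat.mul_le_mul hham ?_
      rw [numUnlabeledSubgraphs, Nat.card_eq_fintype_card]
      exact Finset.card_le_univ _

end SimpleGraph

/-! ### Dense random graphs are mixing and not monotone tiny -/

open MeasureTheory in
-- Union bound over at most `4 ^ Fintype.card V` pairs of sets, each pair requiring at least `m * m`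
-- absent edges.
lemma binomialRandom_real_not_mixing_le {V : Type*} [Fintype V] (p : unitInterval) (m : ℕ) :
    (SimpleGraph.binomialRandom V p).real {G | ¬ G.Mixing m} ≤
      4 ^ Fintype.card V * (1 - (p : ℝ)) ^ (m * m) := by
  classical
  have hp0 : (0 : ℝ) ≤ 1 - p := sub_nonneg.2 p.2.2
  have hp1 : (1 : ℝ) - p ≤ 1 := sub_le_self _ p.2.1
  let s : Finset (Finset V × Finset V) :=
    Finset.univ.filter fun x => Disjoint x.1 x.2 ∧ m ≤ x.1.card ∧ m ≤ x.2.card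
  let F : Finset V × Finset V → Finset (Sym2 V) := fun x => (x.1 ×ˢ x.2).image Sym2.mk.uncurry
  have hsub : {G : SimpleGraph V | ¬ G.Mixing m} ⊆
      ⋃ x ∈ s, {G | ∀ e ∈ F x, e ∉ G.edgeSet} := by
    intro G hG
    simp only [SimpleGraph.Mixing, Set.mem_ofPred_eq] at hG
    push Not at hG
    obtain ⟨A, B, hAB, hA, hB, hno⟩ := hG
    simp only [Set.mem_iUnion]
    refine ⟨(A, B), Finset.mem_filter.2 ⟨Finset.mem_univ _, hAB, hA, hB⟩, ?_⟩
    intro e he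
    obtain ⟨⟨a, b⟩, hab, rfl⟩ := Finset.mem_image.1 he
    rw [Finset.mem_product] at hab
    exact hno a hab.1 b hab.2
  have hbound : ∀ x ∈ s, (SimpleGraph.binomialRandom V p).real {G | ∀ e ∈ F x, e ∉ G.edgeSet} ≤
      (1 - (p : ℝ)) ^ (m * m) := by
    intro x hx
    obtain ⟨-, hd, hA, hB⟩ := Finset.mem_filter.1 hx
    have hdiag : ∀ e ∈ F x, ¬ e.IsDiag := by
      intro e he
      obtain ⟨⟨a, b⟩, hab, rfl⟩ := Finset.mem_image.1 he
      rw [Finset.mem_product] at hab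
      intro h
      have h' : a = b := h
      exact Finset.disjoint_left.1 hd hab.1 (h' ▸ hab.2)
    have hcard : (F x).card = x.1.card * x.2.card := by
      rw [Finset.card_image_of_injOn, Finset.card_product]
      rintro ⟨a, b⟩ hab ⟨a', b'⟩ hab' h
      simp only [Finset.coe_product, Set.mem_prod, Finset.mem_coe] at hab hab'
      have h' : s(a, b) = s(a', b') := h
      rcases Sym2.eq_iff.1 h' with ⟨rfl, rfl⟩ | ⟨rfl, rfl⟩
      · rfl
      · exact (Finset.disjoint_left.1 hd hab.1 hab'.2).elim
    rw [binomialRandom_real_disjoint p _ hdiag, hcard]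
    exact pow_le_pow_of_le_one hp0 hp1 (Nat.mul_le_mul hA hB)
  refine (measureReal_mono hsub (measure_ne_top _ _)).trans ((measureReal_biUnion_finset_le _ _).trans
    ((Finset.sum_le_sum hbound).trans ?_))
  rw [Finset.sum_const, nsmul_eq_mul]
  gcongr
  have : s.card ≤ 4 ^ Fintype.card V := by
    refine (Finset.card_le_univ s).trans ?_
    rw [Fintype.card_prod, Fintype.card_finset, ← mul_pow]
    norm_num
  exact_mod_cast this

/-- For `p = 2 * q ^ 2 / n`, sets of size at least `n / q` give `p * (n / q) ^ 2 = 2 * n`, so the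
failure probability is at most `(4 / exp 2) ^ n`, with base below `1`. -/
lemma whp_mixing {q : ℕ} (hq : 0 < q) :
    WhpGnd (2 * q ^ 2) (fun n G => G.Mixing (n / q + 1)) := by
  have hbase : 4 / Real.exp 2 < 1 := by
    rw [div_lt_one (Real.exp_pos 2), show (2 : ℝ) = 1 + 1 by norm_num, Real.exp_add]
    nlinarith [Real.exp_one_gt_d9]
  refine whpGnd_of_compl_le
    (tendsto_pow_atTop_nhds_zero_of_lt_one (by positivity) hbase) ?_
  filter_upwards [eventually_ge_atTop (2 * q ^ 2), eventually_ge_atTop 1] with n hn hn1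
  have hn' : (0 : ℝ) < n := by exact_mod_cast hn1
  have hq' : (0 : ℝ) < q := by exact_mod_cast hq
  set p := edgeProb (2 * q ^ 2) n with hpdef
  have hp : (p : ℝ) = 2 * q ^ 2 / n := by
    rw [hpdef, edgeProb, Set.coe_projIcc, min_eq_right, max_eq_right (by positivity)]
    rw [div_le_one hn']
    exact_mod_cast hn
  refine (binomialRandom_real_not_mixing_le p _).trans ?_
  rw [Fintype.card_fin, div_pow, div_eq_mul_inv]
  gcongr
  have hm : (n : ℝ) / q ≤ (n / q + 1 : ℕ) := by
    rw [div_le_iff₀ hq']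
    have := (Nat.lt_div_mul_add hq : n < n / q * q + q)
    have h2 : n ≤ (n / q + 1) * q := by rw [add_mul, one_mul]; exact this.le
    exact_mod_cast h2
  calc (1 - (p : ℝ)) ^ ((n / q + 1) * (n / q + 1))
      ≤ Real.exp (-p) ^ ((n / q + 1) * (n / q + 1)) :=
        pow_le_pow_left₀ (sub_nonneg.2 p.2.2) (Real.one_sub_le_exp_neg _) _
    _ = Real.exp (-(p * ((n / q + 1 : ℕ) * (n / q + 1 : ℕ)))) := by
        rw [← Real.exp_nat_mul]
        congr 1
        push_cast
        ring
    _ ≤ Real.exp (-(p * (n / q * (n / q)))) := by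
        have := p.2.1
        refine Real.exp_le_exp.2 (neg_le_neg ?_)
        gcongr
    _ = (Real.exp 2 ^ n)⁻¹ := by
        rw [← Real.exp_nat_mul, ← Real.exp_neg, hp]
        congr 1
        field_simp

/-- The path keeps all but `2 * m` vertices, enough for edge density `e + 1` on it. With `r + 1 ≤ 2
^ (r + 1)`, tininess and the subgraph count compare two `(r + 1)`-st powers; their bases contradict
`he`. -/
lemma not_monotoneTiny_of_mixing {V : Type*} [Fintype V] {G : SimpleGraph V} {c : ℝ} {e m : ℕ}
    (hc : 0 < c) (he : c * (2 * (2 * e + 3)) < 2 ^ e) (hG : G.Mixing (m + 1))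
    (hm : 4 * (m + 1) * (4 * (e + 1) + 1) + 2 * m ≤ Fintype.card V) : ¬ MonotoneTiny c G := by
  intro htiny
  obtain ⟨r, P, hr, hP⟩ := hG.exists_path (by nlinarith)
  have hedge := (hG.comap P).le_ncard_edgeSet (e := e + 1) (by rw [Fintype.card_fin]; omega)
  rw [Fintype.card_fin] at hedge
  have hcount := SimpleGraph.two_pow_le_numUnlabeledSubgraphs P hP hedge
  have hle := htiny (r + 1) (by omega)
  have h1 : (2 : ℝ) ^ (e * (r + 1)) ≤
      (2 ^ (r + 1) * (2 * e + 3) ^ (r + 1)) * c ^ (r + 1) := by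
    calc (2 : ℝ) ^ (e * (r + 1))
        ≤ ((r + 1 : ℕ) * (2 * e + 3) ^ (r + 1)) * numUnlabeledSubgraphs G (r + 1) := by
          exact_mod_cast hcount
      _ ≤ _ := by
          gcongr
          exact_mod_cast Nat.lt_two_pow_self.le
  rw [pow_mul, ← mul_pow, ← mul_pow] at h1
  have h2 := (pow_le_pow_iff_left₀ (by positivity) (by positivity) (Nat.succ_ne_zero r)).1 h1
  linarith

lemma exists_mul_lt_two_pow (c : ℝ) : ∃ e : ℕ, c * (2 * (2 * e + 3)) < 2 ^ e := by
  obtain ⟨a, ha⟩ := exists_nat_ge c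
  -- Here `2 ^ e ≥ 256 * (a + 1) ^ 2`, while the left side is at most `a * (8 * a + 38)`.
  refine ⟨2 * a + 8, ?_⟩
  have h1 : (a : ℝ) + 1 ≤ 2 ^ a := by exact_mod_cast Nat.lt_two_pow_self
  have h2 : (2 : ℝ) ^ (2 * a + 8) = 2 ^ a * 2 ^ a * 256 := by
    rw [pow_add, two_mul, pow_add]; norm_num
  have h0 : (0 : ℝ) ≤ a := Nat.cast_nonneg a
  rw [h2]
  push_cast
  have h3 : ((a : ℝ) + 1) * (a + 1) ≤ 2 ^ a * 2 ^ a :=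
    mul_le_mul h1 h1 (by positivity) (by positivity)
  have h4 : c * (2 * (2 * (2 * a + 8) + 3)) ≤ a * (2 * (2 * (2 * a + 8) + 3)) := by gcongr
  nlinarith

theorem exists_whp_not_monotoneTiny {c : ℝ} (hc : 0 < c) :
    ∃ d : ℝ, 0 ≤ d ∧ WhpGnd d (fun _ G => ¬ MonotoneTiny c G) := by
  obtain ⟨e, he⟩ := exists_mul_lt_two_pow c
  set b := 4 * (e + 1) + 1 with hb
  -- With `m = n / (16 * b)` and `n ≥ 16 * b`, both `4 * m * b` and `4 * b` are at most `n / 4`,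
  -- which leaves room for `2 * m`.
  have hq : 0 < 16 * b := by omega
  refine ⟨2 * (16 * b : ℕ) ^ 2, by positivity, ?_⟩
  refine tendsto_of_tendsto_of_tendsto_of_le_of_le' (whp_mixing hq) tendsto_const_nhds ?_
    (Eventually.of_forall fun n => MeasureTheory.prob_le_one)
  filter_upwards [eventually_ge_atTop (16 * b)] with n hn
  refine MeasureTheory.measure_mono fun G hG => not_monotoneTiny_of_mixing hc he hG ?_
  rw [Fintype.card_fin, ← hb]
  have h1 : n / (16 * b) * (16 * b) ≤ n := Nat.div_mul_le_self _ _
  generalize n / (16 * b) = m at h1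
  nlinarith

theorem theorem1p3 :
    (∀ d₁ : ℝ, 0 ≤ d₁ → ∃ c : ℝ, 0 < c ∧ WhpGnd d₁ (fun _ G => MonotoneTiny c G)) ∧
    (∀ c : ℝ, 0 < c → ∃ d₂ : ℝ, 0 ≤ d₂ ∧ WhpGnd d₂ (fun _ G => ¬ MonotoneTiny c G)) :=
  ⟨fun _ hd => exists_whp_monotoneTiny hd, fun _ hc => exists_whp_not_monotoneTiny hc⟩
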